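/- **Theorem (infinitesimal moments of a Markov counting system).** Let $\zeta$ be a finite set. For each ordered pair $(i,j)$ of distinct elements of $\zeta$ let $\{N_{ij}(t)\}_{t\ge 0}$ be a counting process (values in $\mathbb N$, $N_{ij}(0)=0$, nondecreasing right-continuous paths), all on one probability space, and let $\mathbf X(t)\in\mathbb Z^{\zeta}$, $t\ge 0$, satisfy, for all $c\in\zeta$, $$X_c(t)=X_c(0)+\sum_{i\ne c}N_{ic}(t)-\sum_{j\neq c}N_{cj}(t),$$ where $\mathbf X(0)$ is a random vector. Write $\mathbf N=(N_{ij})_{i\ne j}$ and $\Delta N_{ij}=N_{ij}(t+h)-N_{ij}(t)$. Below, $t\ge 0$, and a condition $\mathbf X(t)=\mathbf x$ is always taken with $P(\mathbf X(t)=\mathbf x)>0$. Assume that $\{\mathbf X(t)\}$ is a time-homogeneous, stable and conservative Markov counting system with associated multivariate counting process $\{\mathbf N(t)\}$, that is: * (Markov) for all $t,h\ge 0$, the conditional law of $\Delta\mathbf N$ given the history of $(\mathbf X,\mathbf N)$ up to time $t$ depends on this history only through $\mathbf X(t)$; * (time homogeneous) for all $h\ge 0$ and $\mathbf x$, the conditional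 law of $\Delta\mathbf N$ given $\mathbf X(t)=\mathbf x$ does not depend on $t$; * (infinitesimal probabilities, stable and conservative) for $i\ne j$ and $k\ge 1$ the limits $$q_{ij}(\mathbf x,k)=\lim_{h\downarrow 0}\frac{P(\Delta N_{ij}=k\text{ and }\Delta N_{lm}=0\text{ for all }(l,m)\ne(i,j)\mid \mathbf X(t)=\mathbf x)}{h},$$ $$\lambda(\mathbf x)=\lim_{h\downarrow 0}\frac{1-P(\Delta N_{ij}=0\text{ for all }(i,j)\mid \mathbf X(t)=\mathbf x)}{h}$$ exist, are finite and depend only on the arguments shown, and $\lambda(\mathbf x)=\sum_{i\ne j}\sum_{k\ge1}q_{ij}(\mathbf x,k)<\infty$. (Thus simultaneous events can occur only within a single $N_{ij}$.) For $\bar h>0$ put $$\bar\Lambda(t)=\sup_{t\le s\le t+\bar h}\lambda(\mathbf X(s)),\qquad \bar Z_{ij}(t)=\sup_{t\le s\le t+\bar h}\bigl(N_{ij}(s)-N_{ij}(s-)\bigr),\qquad N_{ij}(0-)=N_{ij}(0),$$ and consider the conditions * **(P3)** for all $t$, $\mathbf x$ and $i\ne j$ there is $\bar h>0$ with $E[\bar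 Z_{ij}(t)\bar\Lambda(t)\mid \mathbf X(t)=\mathbf x]<\infty$; * **(P4)** for all $t$, $\mathbf x$ and $i\ne j$ there is $\bar h>0$ with $\operatorname{Var}[\bar Z_{ij}(t)\bar\Lambda(t)\mid \mathbf X(t)=\mathbf x]<\infty$. If (P3) holds, then for all $t$, $\mathbf x$ and $i\ne j$ the sum $\sum_{k\ge1}k\,q_{ij}(\mathbf x,k)$ is finite, $E[\Delta N_{ij}\mid\mathbf X(t)=\mathbf x]$ is finite for all small $h>0$, and the infinitesimal mean of $N_{ij}$ is $$\lim_{h\downarrow0}h^{-1}E[N_{ij}(t+h)-N_{ij}(t)\mid \mathbf X(t)=\mathbf x]=\sum_{k\ge1}k\,q_{ij}(\mathbf x,k).$$ If (P4) holds, then for all $t$, $\mathbf x$ and $i\ne j$ the sum $\sum_{k\ge1}k^2 q_{ij}(\mathbf x,k)$ is finite, $E[(\Delta N_{ij})^2\mid\mathbf X(t)=\mathbf x]$ is finite for all small $h>0$, and the infinitesimal variance of $N_{ij}$ is $$\lim_{h\downarrow0}h^{-1}\operatorname{Var}[N_{ij}(t+h)-N_{ij}(t)\mid \mathbf X(t)=\mathbf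 x]=\sum_{k\ge1}k^2\,q_{ij}(\mathbf x,k).$$ -/

import Mathlib

open MeasureTheory ProbabilityTheory Filter Topology Set
open scoped NNReal ENNReal

namespace MCS

variable {Ω ζ : Type*}

/-- The event types: ordered pairs `(i, j)` of distinct conditions, read as a transition from
`i` to `j`. Event types that are not possible in a system have a counting process that is
identically zero. -/
abbrev Transition (ζ : Type*) : Type _ := {p : ζ × ζ // p.1 ≠ p.2}

/-- The increments `N_p (t + h) - N_p t` of all counting processes over `(t, t + h]`; the
subtraction does not truncate, since the paths are nondecreasing. -/
def increment (N : Transition ζ → ℝ≥0 → Ω → ℕ) (t h : ℝ≥0) (ω : Ω) (p : Transition ζ) : ℕ :=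
  N p (t + h) ω - N p t ω

/-- The history of the system up to time `t`, generated by `X u` and `N_p u` for `u ≤ t`. -/
abbrev history (X : ℝ≥0 → Ω → ζ → ℤ) (N : Transition ζ → ℝ≥0 → Ω → ℕ) (t : ℝ≥0) :
    MeasurableSpace Ω :=
  ⨆ u ∈ Set.Iic t, (MeasurableSpace.comap (X u) inferInstance ⊔
    ⨆ p : Transition ζ, MeasurableSpace.comap (N p u) inferInstance)

/-- `N` is a counting process: a random process with values in `ℕ`, starting at zero, with
nondecreasing and right-continuous paths. -/
structure IsCountingProcess [MeasurableSpace Ω] (N : ℝ≥0 → Ω → ℕ) : Prop where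
  measurable : ∀ t, Measurable (N t)
  zero : ∀ ω, N 0 ω = 0
  mono : ∀ ω, Monotone fun t => N t ω
  right_continuous : ∀ ω t, ContinuousWithinAt (fun s => N s ω) (Set.Ici t) t

/-- A Markov counting system `X` on the finite set of conditions `ζ`, with associated
multivariate counting process `N`. -/
structure IsMarkovCountingSystem [Fintype ζ] [DecidableEq ζ] [MeasurableSpace Ω] (μ : Measure Ω)
    (X : ℝ≥0 → Ω → ζ → ℤ) (N : Transition ζ → ℝ≥0 → Ω → ℕ) : Prop where
  measurable_initial : Measurable (X 0)
  counting : ∀ p, IsCountingProcess (N p)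
  /-- Conservation of mass. -/
  mass_conservation : ∀ t ω c,
    X t ω c = X 0 ω c + ∑ p : Transition ζ with p.1.2 = c, (N p t ω : ℤ)
      - ∑ p : Transition ζ with p.1.1 = c, (N p t ω : ℤ)
  /-- Markov property: given the history up to time `t`, the law of the increments after `t`
  depends on that history only through `X t`. -/
  markov : ∀ (t h : ℝ≥0) (x : ζ → ℤ) (ν : Transition ζ → ℕ) (A : Set Ω),
    MeasurableSet[history X N t] A → μ (A ∩ X t ⁻¹' {x}) ≠ 0 →
      μ[|A ∩ X t ⁻¹' {x}] {ω | increment N t h ω = ν} =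
        μ[|X t ⁻¹' {x}] {ω | increment N t h ω = ν}

/-- Time homogeneity: the law of the increments over `(t, t + h]` given `X t = x` is the same for
all `t` at which this conditional law is defined. -/
def IsTimeHomogeneous [MeasurableSpace Ω] (μ : Measure Ω)
    (X : ℝ≥0 → Ω → ζ → ℤ) (N : Transition ζ → ℝ≥0 → Ω → ℕ) : Prop :=
  ∀ (t t' h : ℝ≥0) (x : ζ → ℤ) (ν : Transition ζ → ℕ),
    μ (X t ⁻¹' {x}) ≠ 0 → μ (X t' ⁻¹' {x}) ≠ 0 →
      μ[|X t ⁻¹' {x}] {ω | increment N t h ω = ν} =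
        μ[|X t' ⁻¹' {x}] {ω | increment N t' h ω = ν}

/-- `q p x k` is, for `k ≥ 1`, the infinitesimal probability that exactly `k` events of type `p`,
and no events of any other type, occur when the system is in state `x`. -/
def HasInfinitesimalProbabilities [MeasurableSpace Ω] (μ : Measure Ω)
    (X : ℝ≥0 → Ω → ζ → ℤ) (N : Transition ζ → ℝ≥0 → Ω → ℕ)
    (q : Transition ζ → (ζ → ℤ) → ℕ+ → ℝ≥0) : Prop :=
  ∀ (t : ℝ≥0) (x : ζ → ℤ), μ (X t ⁻¹' {x}) ≠ 0 → ∀ (p : Transition ζ) (k : ℕ+),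
    Tendsto (fun h : ℝ≥0 => (μ[|X t ⁻¹' {x}]).real
        {ω | increment N t h ω p = k ∧ ∀ p', p' ≠ p → increment N t h ω p' = 0} / (h : ℝ))
      (𝓝[>] 0) (𝓝 (q p x k : ℝ))

/-- `lam x` is the rate at which events (of any type) occur when the system is in state `x`. -/
def HasRateFunction [MeasurableSpace Ω] (μ : Measure Ω)
    (X : ℝ≥0 → Ω → ζ → ℤ) (N : Transition ζ → ℝ≥0 → Ω → ℕ)
    (lam : (ζ → ℤ) → ℝ≥0) : Prop :=
  ∀ (t : ℝ≥0) (x : ζ → ℤ), μ (X t ⁻¹' {x}) ≠ 0 →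
    Tendsto (fun h : ℝ≥0 => (1 - (μ[|X t ⁻¹' {x}]).real
        {ω | ∀ p, increment N t h ω p = 0}) / (h : ℝ))
      (𝓝[>] 0) (𝓝 (lam x : ℝ))

/-- Stable and conservative: `lam x = ∑ q p x k < ∞`, the sum being over all event types `p` and
all `k ≥ 1` (`lam` has finite values). -/
def IsStableConservative [MeasurableSpace Ω] (μ : Measure Ω) (X : ℝ≥0 → Ω → ζ → ℤ)
    (q : Transition ζ → (ζ → ℤ) → ℕ+ → ℝ≥0) (lam : (ζ → ℤ) → ℝ≥0) : Prop :=
  ∀ (t : ℝ≥0) (x : ζ → ℤ), μ (X t ⁻¹' {x}) ≠ 0 →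
    HasSum (fun a : Transition ζ × ℕ+ => q a.1 x a.2) (lam x)

/-- The largest rate met in `[t, t + hbar]`. -/
noncomputable def rateBound (X : ℝ≥0 → Ω → ζ → ℤ) (lam : (ζ → ℤ) → ℝ≥0) (t hbar : ℝ≥0) (ω : Ω) :
    ℝ≥0∞ :=
  ⨆ s ∈ Set.Icc t (t + hbar), (lam (X s ω) : ℝ≥0∞)

/-- The largest jump `N s - N (s-)` of a counting process with `s` in `[t, t + hbar]` (there is no
jump at time zero: `Function.leftLim f 0 = f 0` on `ℝ≥0`). -/
noncomputable def jumpBound (N : ℝ≥0 → Ω → ℕ) (t hbar : ℝ≥0) (ω : Ω) : ℝ≥0∞ :=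
  ⨆ s ∈ Set.Icc t (t + hbar), ((N s ω - Function.leftLim (fun u => N u ω) s : ℕ) : ℝ≥0∞)

/-- First moment condition: for all `t`, `x`, `p` there is `hbar > 0` such that the product of
`jumpBound` and `rateBound` has a finite mean given `X t = x`. -/
def P3 [MeasurableSpace Ω] (μ : Measure Ω) (X : ℝ≥0 → Ω → ζ → ℤ)
    (N : Transition ζ → ℝ≥0 → Ω → ℕ) (lam : (ζ → ℤ) → ℝ≥0) : Prop :=
  ∀ (t : ℝ≥0) (x : ζ → ℤ), μ (X t ⁻¹' {x}) ≠ 0 → ∀ p : Transition ζ, ∃ hbar : ℝ≥0, 0 < hbar ∧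
    ∫⁻ ω, jumpBound (N p) t hbar ω * rateBound X lam t hbar ω ∂(μ[|X t ⁻¹' {x}]) < ⊤

/-- Second moment condition: the same with a finite variance. (The product is finite at every
`ω`, and `evariance` of a nonnegative random variable without a finite mean is `⊤`.) -/
def P4 [MeasurableSpace Ω] (μ : Measure Ω) (X : ℝ≥0 → Ω → ζ → ℤ)
    (N : Transition ζ → ℝ≥0 → Ω → ℕ) (lam : (ζ → ℤ) → ℝ≥0) : Prop :=
  ∀ (t : ℝ≥0) (x : ζ → ℤ), μ (X t ⁻¹' {x}) ≠ 0 → ∀ p : Transition ζ, ∃ hbar : ℝ≥0, 0 < hbar ∧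
    evariance (fun ω => (jumpBound (N p) t hbar ω * rateBound X lam t hbar ω).toReal)
      (μ[|X t ⁻¹' {x}]) < ⊤

/-- `m` is the infinitesimal mean of `N_p` at time `t` in state `x`: the increments over short
intervals have a finite mean given `X t = x`, and this mean divided by `h` tends to `m`. -/
def HasInfinitesimalMean [MeasurableSpace Ω] (μ : Measure Ω) (X : ℝ≥0 → Ω → ζ → ℤ)
    (N : Transition ζ → ℝ≥0 → Ω → ℕ) (p : Transition ζ) (t : ℝ≥0) (x : ζ → ℤ) (m : ℝ) : Prop :=
  (∀ᶠ h : ℝ≥0 in 𝓝[>] 0,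
    Integrable (fun ω => (increment N t h ω p : ℝ)) (μ[|X t ⁻¹' {x}])) ∧
  Tendsto (fun h : ℝ≥0 => (∫ ω, (increment N t h ω p : ℝ) ∂(μ[|X t ⁻¹' {x}])) / (h : ℝ))
    (𝓝[>] 0) (𝓝 m)

/-- `v` is the infinitesimal variance of `N_p` at time `t` in state `x`: the increments over short
intervals have a finite second moment given `X t = x`, and their variance divided by `h` tends
to `v`. -/
def HasInfinitesimalVariance [MeasurableSpace Ω] (μ : Measure Ω) (X : ℝ≥0 → Ω → ζ → ℤ)
    (N : Transition ζ → ℝ≥0 → Ω → ℕ) (p : Transition ζ) (t : ℝ≥0) (x : ζ → ℤ) (v : ℝ) : Prop :=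
  (∀ᶠ h : ℝ≥0 in 𝓝[>] 0,
    MemLp (fun ω => (increment N t h ω p : ℝ)) 2 (μ[|X t ⁻¹' {x}])) ∧
  Tendsto (fun h : ℝ≥0 =>
      variance (fun ω => (increment N t h ω p : ℝ)) (μ[|X t ⁻¹' {x}]) / (h : ℝ))
    (𝓝[>] 0) (𝓝 v)

end MCS

namespace MCS

section History

variable {ζ Ω : Type*} {X : ℝ≥0 → Ω → ζ → ℤ} {N : Transition ζ → ℝ≥0 → Ω → ℕ}

lemma measurable_state_history {u t : ℝ≥0} (hu : u ≤ t) : Measurable[history X N t] (X u) :=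
  Measurable.mono (comap_measurable (X u))
    (le_iSup₂_of_le (f := fun u (_ : u ∈ Set.Iic t) => (MeasurableSpace.comap (X u) inferInstance ⊔
      ⨆ p : Transition ζ, MeasurableSpace.comap (N p u) inferInstance)) u hu le_sup_left) le_rfl

lemma measurable_counting_history {u t : ℝ≥0} (hu : u ≤ t) (p : Transition ζ) :
    Measurable[history X N t] (N p u) :=
  Measurable.mono (comap_measurable (N p u))
    (le_iSup₂_of_le (f := fun u (_ : u ∈ Set.Iic t) => (MeasurableSpace.comap (X u) inferInstance ⊔
      ⨆ p : Transition ζ, MeasurableSpace.comap (N p u) inferInstance)) u hu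
      (le_sup_of_le_right (le_iSup (fun p => MeasurableSpace.comap (N p u) inferInstance) p)))
    le_rfl

lemma measurable_increment_history {s h t : ℝ≥0} (hs : s + h ≤ t) :
    Measurable[history X N t] (increment N s h) := by
  have h1 := fun p => measurable_counting_history (X := X) (N := N) hs p
  have h2 := fun p => measurable_counting_history (X := X) (N := N) (le_self_add.trans hs) p
  generalize history X N t = m at h1 h2 ⊢
  exact measurable_pi_lambda _ fun p => (h1 p).sub (h2 p)

lemma measurableSet_noIncrement_history [Finite ζ] {s a u : ℝ≥0} (hu : s + a ≤ u) :
    MeasurableSet[history X N u] {ω | increment N s a ω = 0} :=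
  measurable_increment_history hu (measurableSet_singleton 0)

end History

section Paths

variable {ζ Ω : Type*} [Fintype ζ] [DecidableEq ζ] [MeasurableSpace Ω] {μ : Measure Ω}
  {X : ℝ≥0 → Ω → ζ → ℤ} {N : Transition ζ → ℝ≥0 → Ω → ℕ}

namespace IsMarkovCountingSystem

lemma measurable_state (hX : IsMarkovCountingSystem μ X N) (t : ℝ≥0) : Measurable (X t) := by
  refine measurable_pi_iff.2 fun c => ?_
  have h : (fun ω => X t ω c) = fun ω => X 0 ω c
      + ∑ p : Transition ζ with p.1.2 = c, (N p t ω : ℤ)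
      - ∑ p : Transition ζ with p.1.1 = c, (N p t ω : ℤ) :=
    funext fun ω => hX.mass_conservation t ω c
  have hN : ∀ p, Measurable fun ω => (N p t ω : ℤ) := fun p =>
    (measurable_of_countable (fun n : ℕ => (n : ℤ))).comp ((hX.counting p).measurable t)
  rw [h]
  exact (((measurable_pi_apply c).comp hX.measurable_initial).add
    (Finset.measurable_sum _ fun p _ => hN p)).sub (Finset.measurable_sum _ fun p _ => hN p)

lemma measurable_increment (hX : IsMarkovCountingSystem μ X N) (t h : ℝ≥0) :
    Measurable (increment N t h) :=
  measurable_pi_iff.2 fun p => ((hX.counting p).measurable (t + h)).sub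
    ((hX.counting p).measurable t)

lemma history_le (hX : IsMarkovCountingSystem μ X N) (t : ℝ≥0) :
    history X N t ≤ (inferInstance : MeasurableSpace Ω) := by
  refine iSup₂_le fun u _ => sup_le ?_ (iSup_le fun p => ?_)
  · exact (hX.measurable_state u).comap_le
  · exact ((hX.counting p).measurable u).comap_le

lemma increment_add (hX : IsMarkovCountingSystem μ X N) (t a b : ℝ≥0) (ω : Ω) :
    increment N t (a + b) ω = increment N t a ω + increment N (t + a) b ω := by
  funext p
  have h1 : N p t ω ≤ N p (t + a) ω := (hX.counting p).mono ω le_self_add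
  have h2 : N p (t + a) ω ≤ N p (t + a + b) ω := (hX.counting p).mono ω le_self_add
  simp only [increment, Pi.add_apply, ← add_assoc]
  omega

lemma state_eq_of_increment_eq_zero (hX : IsMarkovCountingSystem μ X N) {t h : ℝ≥0} {ω : Ω}
    (h0 : increment N t h ω = 0) : X (t + h) ω = X t ω := by
  have hN : ∀ p, N p (t + h) ω = N p t ω := fun p => by
    have h1 : N p t ω ≤ N p (t + h) ω := (hX.counting p).mono ω le_self_add
    have h2 : N p (t + h) ω - N p t ω = 0 := congrFun h0 p
    omega
  funext c
  rw [hX.mass_conservation (t + h), hX.mass_conservation t]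
  simp only [hN]

lemma increment_mono (hX : IsMarkovCountingSystem μ X N) {t s a b : ℝ≥0} (hts : t ≤ s)
    (hst : s + a ≤ t + b) (ω : Ω) : increment N s a ω ≤ increment N t b ω := fun p =>
  Nat.sub_le_sub_left ((hX.counting p).mono ω hts) _ |>.trans'
    (Nat.sub_le_sub_right ((hX.counting p).mono ω hst) _)

end IsMarkovCountingSystem

/-- The law of the increments over `(s, s + h]` given `X s = y`. -/
noncomputable def condLaw (μ : Measure Ω) (X : ℝ≥0 → Ω → ζ → ℤ)
    (N : Transition ζ → ℝ≥0 → Ω → ℕ) (s h : ℝ≥0) (y : ζ → ℤ) : Measure (Transition ζ → ℕ) :=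
  (μ[|X s ⁻¹' {y}]).map (increment N s h)

lemma condLaw_real_zero (hX : IsMarkovCountingSystem μ X N) (s h : ℝ≥0) (y : ζ → ℤ) :
    (condLaw μ X N s h y).real {0} = (μ[|X s ⁻¹' {y}]).real {ω | ∀ p, increment N s h ω p = 0} := by
  rw [measureReal_def, condLaw, Measure.map_apply (hX.measurable_increment _ _)
    (measurableSet_singleton _), measureReal_def]
  congr 2
  ext ω; simp [funext_iff]

end Paths

section Law

variable {ζ Ω : Type*} [Fintype ζ] [DecidableEq ζ] [MeasurableSpace Ω] {μ : Measure Ω}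
  [IsProbabilityMeasure μ] {X : ℝ≥0 → Ω → ζ → ℤ} {N : Transition ζ → ℝ≥0 → Ω → ℕ}

/-- Markov property and time homogeneity, conditionally on `X t = x` and relative to a reference
time `r`. -/
lemma map_restrict_increment (hX : IsMarkovCountingSystem μ X N) (hhom : IsTimeHomogeneous μ X N)
    {t s r : ℝ≥0} (h : ℝ≥0) (hts : t ≤ s) {x y : ζ → ℤ} (hr : μ (X r ⁻¹' {y}) ≠ 0) {A : Set Ω}
    (hA : MeasurableSet[history X N s] A) (hAy : A ⊆ X s ⁻¹' {y}) :
    ((μ[|X t ⁻¹' {x}]).restrict A).map (increment N s h)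
      = (μ[|X t ⁻¹' {x}]) A • condLaw μ X N r h y := by
  have hm := hX.measurable_increment s h
  have hA' := hX.history_le s A hA
  have hB : MeasurableSet (X t ⁻¹' {x}) := hX.measurable_state t (measurableSet_singleton x)
  refine Measure.ext_of_singleton fun ν => ?_
  have hν : MeasurableSet {ω | increment N s h ω = ν} := hm (measurableSet_singleton ν)
  rw [Measure.map_apply hm (measurableSet_singleton ν), Measure.restrict_apply (hm
    (measurableSet_singleton ν)), Measure.smul_apply, condLaw, Measure.map_apply
    (hX.measurable_increment r h) (measurableSet_singleton ν), cond_apply hB, cond_apply hB,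
    smul_eq_mul, mul_assoc]
  congr 1
  set D := X t ⁻¹' {x} ∩ A with hD
  have hDs : MeasurableSet[history X N s] D :=
    (measurable_state_history hts (measurableSet_singleton x)).inter hA
  have hDX : D ∩ X s ⁻¹' {y} = D := inter_eq_left.2 (inter_subset_right.trans hAy)
  have e1 : X t ⁻¹' {x} ∩ (increment N s h ⁻¹' {ν} ∩ A) = D ∩ {ω | increment N s h ω = ν} := by
    ext ω; simp [hD]; tauto
  rw [e1]
  by_cases h0 : μ D = 0
  · rw [h0, zero_mul]; exact measure_mono_null inter_subset_left h0
  · have h1 := hX.markov s h y ν D hDs (by rwa [hDX])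
    rw [hDX] at h1
    have h2 : μ (X s ⁻¹' {y}) ≠ 0 := fun h' =>
      h0 (measure_mono_null (inter_subset_right.trans hAy) h')
    rw [hhom s r h y ν h2 hr] at h1
    change _ = μ D * (μ[|X r ⁻¹' {y}]) {ω | increment N r h ω = ν}
    rw [← h1, cond_apply (hX.history_le s D hDs), ← mul_assoc,
      ENNReal.mul_inv_cancel h0 (measure_ne_top _ _), one_mul]

lemma setLIntegral_increment (hX : IsMarkovCountingSystem μ X N) (hhom : IsTimeHomogeneous μ X N)
    {t s r : ℝ≥0} (h : ℝ≥0) (hts : t ≤ s) {x y : ζ → ℤ} (hr : μ (X r ⁻¹' {y}) ≠ 0) {A : Set Ω}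
    (hA : MeasurableSet[history X N s] A) (hAy : A ⊆ X s ⁻¹' {y})
    (F : (Transition ζ → ℕ) → ℝ≥0∞) :
    ∫⁻ ω in A, F (increment N s h ω) ∂(μ[|X t ⁻¹' {x}])
      = (μ[|X t ⁻¹' {x}]) A * ∫⁻ ν, F ν ∂(condLaw μ X N r h y) := by
  rw [← smul_eq_mul, ← lintegral_smul_measure, ← map_restrict_increment hX hhom h hts hr hA hAy,
    lintegral_map (measurable_of_countable F) (hX.measurable_increment s h)]

lemma measure_inter_increment_eq_zero (hX : IsMarkovCountingSystem μ X N)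
    (hhom : IsTimeHomogeneous μ X N) {t s r : ℝ≥0} (h : ℝ≥0) (hts : t ≤ s) {x y : ζ → ℤ}
    (hr : μ (X r ⁻¹' {y}) ≠ 0) {A : Set Ω} (hA : MeasurableSet[history X N s] A)
    (hAy : A ⊆ X s ⁻¹' {y}) :
    (μ[|X t ⁻¹' {x}]) (A ∩ {ω | increment N s h ω = 0})
      = (μ[|X t ⁻¹' {x}]) A * condLaw μ X N r h y {0} := by
  have h1 := congrArg (fun m => m {0}) (map_restrict_increment hX hhom h hts hr hA hAy (x := x))
  have hm := hX.measurable_increment s h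
  simp only [Measure.map_apply hm (measurableSet_singleton 0), Measure.restrict_apply (hm
    (measurableSet_singleton 0)), Measure.smul_apply, smul_eq_mul] at h1
  rw [← h1, inter_comm]; rfl

lemma isProbabilityMeasure_condLaw (hX : IsMarkovCountingSystem μ X N) {s : ℝ≥0} (h : ℝ≥0)
    {y : ζ → ℤ} (hs : μ (X s ⁻¹' {y}) ≠ 0) : IsProbabilityMeasure (condLaw μ X N s h y) := by
  have := cond_isProbabilityMeasure hs
  exact Measure.isProbabilityMeasure_map (hX.measurable_increment s h).aemeasurable

lemma condLaw_zero_add (hX : IsMarkovCountingSystem μ X N) (hhom : IsTimeHomogeneous μ X N)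
    {s : ℝ≥0} (a b : ℝ≥0) {y : ζ → ℤ} (hs : μ (X s ⁻¹' {y}) ≠ 0) :
    condLaw μ X N s (a + b) y {0} = condLaw μ X N s a y {0} * condLaw μ X N s b y {0} := by
  have := cond_isProbabilityMeasure hs
  have hy : MeasurableSet[history X N s] (X s ⁻¹' {y}) :=
    measurable_state_history le_rfl (measurableSet_singleton y)
  have hy' : MeasurableSet[history X N (s + a)] (X s ⁻¹' {y}) :=
    measurable_state_history le_self_add (measurableSet_singleton y)
  have hone : (μ[|X s ⁻¹' {y}]) (X s ⁻¹' {y}) = 1 := cond_apply_self hs (measure_ne_top _ _)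
  have h1 := measure_inter_increment_eq_zero hX hhom (t := s) (x := y) a le_rfl hs hy subset_rfl
  have h2 := measure_inter_increment_eq_zero hX hhom (t := s) (x := y) (a + b) le_rfl hs hy
    subset_rfl
  have h3 := measure_inter_increment_eq_zero hX hhom (t := s) (s := s + a) (x := y) (y := y) b
    le_self_add hs (A := X s ⁻¹' {y} ∩ {ω | increment N s a ω = 0})
    (hy'.inter (measurableSet_noIncrement_history le_rfl)) (fun ω hω =>
      (hX.state_eq_of_increment_eq_zero hω.2).trans hω.1)
  rw [hone, one_mul] at h1 h2
  rw [← h2, ← h1, ← h3, inter_assoc]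
  congr 2
  ext ω
  simp [hX.increment_add]

lemma condLaw_zero_nsmul (hX : IsMarkovCountingSystem μ X N) (hhom : IsTimeHomogeneous μ X N)
    {s : ℝ≥0} (a : ℝ≥0) {y : ζ → ℤ} (hs : μ (X s ⁻¹' {y}) ≠ 0) (n : ℕ) :
    condLaw μ X N s (n * a) y {0} = condLaw μ X N s a y {0} ^ n := by
  induction n with
  | zero =>
    have := cond_isProbabilityMeasure hs
    rw [condLaw, Measure.map_apply (hX.measurable_increment _ _) (measurableSet_singleton _)]
    have : increment N s (((0 : ℕ) : ℝ≥0) * a) ⁻¹' {0} = univ := by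
      ext ω; simp [funext_iff, increment]
    rw [this, pow_zero, measure_univ]
  | succ n ih => rw [Nat.cast_succ, add_mul, one_mul, condLaw_zero_add hX hhom _ _ hs, ih, pow_succ]

/-- Linear bound for the probability that no event occurs. -/
lemma one_sub_rate_mul_le (hX : IsMarkovCountingSystem μ X N) (hhom : IsTimeHomogeneous μ X N)
    {lam : (ζ → ℤ) → ℝ≥0} (hlam : HasRateFunction μ X N lam) {s : ℝ≥0} (h : ℝ≥0) {y : ζ → ℤ}
    (hs : μ (X s ⁻¹' {y}) ≠ 0) :
    1 - (lam y : ℝ) * h ≤ (condLaw μ X N s h y).real {0} := by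
  rcases eq_or_ne h 0 with rfl | hh
  · have := condLaw_zero_nsmul hX hhom 0 hs 0
    simp only [Nat.cast_zero, mul_zero, pow_zero] at this
    simp [measureReal_def, this]
  have hpos : 0 < h := pos_iff_ne_zero.2 hh
  have hlim : Tendsto (fun n : ℕ => h / ((n : ℝ≥0) + 1)) atTop (𝓝[>] 0) := by
    refine tendsto_nhdsWithin_iff.2 ⟨?_, Eventually.of_forall fun n => ?_⟩
    · rw [← NNReal.tendsto_coe]
      have := tendsto_const_div_atTop_nhds_zero_nat (h : ℝ)
      simpa using (tendsto_add_atTop_iff_nat 1).2 this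
    · exact div_pos hpos (by positivity)
  have h1 := (hlam s y hs).comp hlim
  have h2 : Tendsto (fun n : ℕ => 1 - (h : ℝ) * ((1 - (condLaw μ X N s (h / ((n : ℝ≥0) + 1)) y).real
      {0}) / ((h / ((n : ℝ≥0) + 1) : ℝ≥0) : ℝ))) atTop (𝓝 (1 - h * lam y)) := by
    simp only [condLaw_real_zero hX]
    exact (h1.const_mul (h : ℝ)).const_sub 1
  rw [mul_comm]
  refine le_of_tendsto h2 (Eventually.of_forall fun n => ?_)
  set d := h / ((n : ℝ≥0) + 1) with hd
  have e : h = ((n + 1 : ℕ) : ℝ≥0) * d := by rw [hd]; push_cast; field_simp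
  have e' : (h : ℝ) = ((n + 1 : ℕ) : ℝ) * d := by exact_mod_cast congrArg NNReal.toReal e
  have hdpos : (0 : ℝ) < d := by rw [hd]; positivity
  set g := (condLaw μ X N s d y).real {0} with hg
  have hpow : (condLaw μ X N s h y).real {0} = g ^ (n + 1) := by
    rw [measureReal_def, e, condLaw_zero_nsmul hX hhom d hs, ENNReal.toReal_pow]; rfl
  have hg0 : 0 ≤ g := measureReal_nonneg
  have := one_add_mul_le_pow (a := g - 1) (by linarith) (n + 1)
  rw [add_sub_cancel] at this
  rw [hpow]
  refine le_trans (le_of_eq ?_) this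
  rw [e']
  field_simp
  ring

end Law

lemma history_mono {ζ Ω : Type*} {X : ℝ≥0 → Ω → ζ → ℤ} {N : Transition ζ → ℝ≥0 → Ω → ℕ}
    {s t : ℝ≥0} (hst : s ≤ t) : history X N s ≤ history X N t :=
  biSup_mono fun _ hu => le_trans (mem_Iic.1 hu) hst

lemma lintegral_mul_le_of_setLIntegral_le {Ω : Type*} {m m0 : MeasurableSpace Ω} (hm : m ≤ m0)
    {P : Measure[m0] Ω} {f g u : Ω → ℝ≥0∞} (hf : Measurable[m0] f) (hg : Measurable[m0] g)
    (hu : Measurable[m] u)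
    (h : ∀ A, MeasurableSet[m] A → ∫⁻ ω in A, f ω ∂P ≤ ∫⁻ ω in A, g ω ∂P) :
    ∫⁻ ω, f ω * u ω ∂P ≤ ∫⁻ ω, g ω * u ω ∂P := by
  have hu' : Measurable[m0] u := hu.mono hm le_rfl
  have hle : (P.withDensity f).trim hm ≤ (P.withDensity g).trim hm := by
    refine Measure.le_iff.2 fun A hA => ?_
    rw [trim_measurableSet_eq hm hA, trim_measurableSet_eq hm hA, withDensity_apply _ (hm A hA),
      withDensity_apply _ (hm A hA)]
    exact h A hA
  have h1 := lintegral_mono' hle (le_refl u)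
  rwa [lintegral_trim hm hu, lintegral_trim hm hu, lintegral_withDensity_eq_lintegral_mul _ hf hu',
    lintegral_withDensity_eq_lintegral_mul _ hg hu'] at h1

section FirstEvent

variable {ζ Ω : Type*} [Fintype ζ] [DecidableEq ζ] [MeasurableSpace Ω] {μ : Measure Ω}
  {X : ℝ≥0 → Ω → ζ → ℤ} {N : Transition ζ → ℝ≥0 → Ω → ℕ}

/-- At most one cell of a grid is preceded by no event at all and contains an event. -/
lemma sum_first_event_le (hX : IsMarkovCountingSystem μ X N)
    {F : (Transition ζ → ℕ) → ℝ≥0∞} (hF : F 0 = 0) (s δ : ℝ≥0) (ω : Ω) (G : ℝ≥0∞) (n : ℕ)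
    (hG : ∀ l < n, F (increment N (s + l * δ) δ ω) ≤ G) :
    ∑ l ∈ Finset.range n, (if increment N s (l * δ) ω = 0
        then F (increment N (s + l * δ) δ ω) else 0)
      ≤ if increment N s (n * δ) ω = 0 then 0 else G := by
  induction n with
  | zero => simp
  | succ n ih =>
    specialize ih fun l hl => hG l (hl.trans n.lt_succ_self)
    have hadd := hX.increment_add s (n * δ) δ ω
    rw [Finset.sum_range_succ, Nat.cast_succ, add_mul, one_mul, hadd]
    have hGn := hG n n.lt_succ_self
    by_cases h0 : increment N s (n * δ) ω = 0
    · rw [if_pos h0] at ih ⊢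
      rw [h0, zero_add, nonpos_iff_eq_zero.1 ih, zero_add]
      split_ifs with h1
      · rw [h1, hF]
      · exact hGn
    · rw [if_neg h0] at ih ⊢
      rw [add_zero, if_neg]
      · exact ih
      · exact fun h => h0 (add_eq_zero.1 h).1

variable [IsProbabilityMeasure μ]

lemma lintegral_first_event_le (hX : IsMarkovCountingSystem μ X N)
    (hhom : IsTimeHomogeneous μ X N) {t s r : ℝ≥0} (δ : ℝ≥0) (hts : t ≤ s) {x y : ζ → ℤ}
    (hr : μ (X r ⁻¹' {y}) ≠ 0) {A : Set Ω} (hA : MeasurableSet[history X N s] A)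
    (hAy : A ⊆ X s ⁻¹' {y}) {F : (Transition ζ → ℕ) → ℝ≥0∞} (hF : F 0 = 0) {G : Ω → ℝ≥0∞}
    {n : ℕ} (hG : ∀ l < n, ∀ ω, F (increment N (s + l * δ) δ ω) ≤ G ω) :
    (μ[|X t ⁻¹' {x}]) A * (∫⁻ ν, F ν ∂(condLaw μ X N r δ y))
      * ∑ l ∈ Finset.range n, condLaw μ X N r δ y {0} ^ l
      ≤ ∫⁻ ω in A, G ω ∂(μ[|X t ⁻¹' {x}]) := by
  set P := μ[|X t ⁻¹' {x}] with hP
  have hmF : ∀ u, Measurable fun ω => F (increment N u δ ω) := fun u =>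
    (measurable_of_countable F).comp (hX.measurable_increment u δ)
  have hm0 : ∀ u v, MeasurableSet {ω | increment N u v ω = 0} := fun u v =>
    hX.measurable_increment u v (measurableSet_singleton 0)
  have hAm := hX.history_le s A hA
  calc _ = ∑ l ∈ Finset.range n, ∫⁻ ω in A, (if increment N s (l * δ) ω = 0
        then F (increment N (s + l * δ) δ ω) else 0) ∂P := by
        rw [Finset.mul_sum]
        refine Finset.sum_congr rfl fun l _ => ?_
        have h1 : ∀ ω, (if increment N s (l * δ) ω = 0
            then F (increment N (s + l * δ) δ ω) else 0)
            = {ω | increment N s (l * δ) ω = 0}.indicator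
              (fun ω => F (increment N (s + l * δ) δ ω)) ω := fun ω => by
          simp [indicator_apply]
        simp_rw [h1]
        rw [lintegral_indicator (hm0 _ _), Measure.restrict_restrict (hm0 _ _), inter_comm,
          setLIntegral_increment hX hhom δ (hts.trans le_self_add) hr (y := y),
          measure_inter_increment_eq_zero hX hhom _ hts hr hA hAy, condLaw_zero_nsmul hX hhom δ hr]
        · rw [hP]; ring
        · have : MeasurableSet[history X N (s + l * δ)] A := history_mono le_self_add A hA
          exact this.inter (measurableSet_noIncrement_history le_rfl)
        · exact fun ω hω => (hX.state_eq_of_increment_eq_zero hω.2).trans (hAy hω.1)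
    _ = ∫⁻ ω in A, ∑ l ∈ Finset.range n, (if increment N s (l * δ) ω = 0
        then F (increment N (s + l * δ) δ ω) else 0) ∂P := by
        rw [lintegral_finsetSum]
        exact fun l _ => Measurable.ite (hm0 _ _) (hmF _) measurable_const
    _ ≤ ∫⁻ ω in A, G ω ∂P := by
        refine lintegral_mono fun ω => (sum_first_event_le hX hF s δ ω (G ω) n
          fun l hl => hG l hl ω).trans ?_
        split_ifs <;> simp

variable {lam : (ζ → ℤ) → ℝ≥0}

lemma setLIntegral_increment_le_of_subset (hX : IsMarkovCountingSystem μ X N)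
    (hhom : IsTimeHomogeneous μ X N) (hlam : HasRateFunction μ X N lam)
    {t s δ : ℝ≥0} (hts : t ≤ s) {x y : ζ → ℤ}
    {A : Set Ω} (hA : MeasurableSet[history X N s] A)
    (hAy : A ⊆ X s ⁻¹' {y}) {F : (Transition ζ → ℕ) → ℝ≥0∞} (hF : F 0 = 0) {G : Ω → ℝ≥0∞}
    {n : ℕ} (hG : ∀ l < n, ∀ ω, F (increment N (s + l * δ) δ ω) ≤ G ω)
    {M c : ℝ≥0} (hM : lam y ≤ M) (hMδ : M * δ ≤ 1) (hc : (c : ℝ) ≤ 1 - (1 - M * δ) ^ n) :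
    c * ∫⁻ ω in A, F (increment N s δ ω) ∂(μ[|X t ⁻¹' {x}])
      ≤ δ * (M * ∫⁻ ω in A, G ω ∂(μ[|X t ⁻¹' {x}])) := by
  by_cases h0 : (μ[|X t ⁻¹' {x}]) A = 0
  · rw [setLIntegral_measure_zero _ _ h0, mul_zero]; exact zero_le
  have hs : μ (X s ⁻¹' {y}) ≠ 0 := fun h => h0 (cond_absolutelyContinuous
    (measure_mono_null hAy h))
  have hprob := isProbabilityMeasure_condLaw (N := N) hX δ hs
  rw [setLIntegral_increment hX hhom δ hts hs hA hAy F]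
  have h1 := lintegral_first_event_le hX hhom (x := x) δ hts hs hA hAy hF hG
  set K := (μ[|X t ⁻¹' {x}]) A * ∫⁻ ν, F ν ∂(condLaw μ X N s δ y)
  have hle : (c : ℝ≥0∞) ≤ δ * (M * ∑ l ∈ Finset.range n, condLaw μ X N s δ y {0} ^ l) := by
    have hg := one_sub_rate_mul_le hX hhom hlam δ hs
    set g := (condLaw μ X N s δ y).real {0} with hgdef
    have hg' : condLaw μ X N s δ y {0} = ENNReal.ofReal g := by simp [hgdef]
    have hg0 : 0 ≤ g := measureReal_nonneg
    have hMg : 1 - (M : ℝ) * δ ≤ g := by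
      refine le_trans ?_ hg
      have : (lam y : ℝ) * δ ≤ M * δ := by gcongr
      linarith
    have hMδ' : 0 ≤ 1 - (M : ℝ) * δ := by
      have : (M : ℝ) * δ ≤ 1 := by exact_mod_cast hMδ
      linarith
    have h2 : (c : ℝ) ≤ δ * (M * ∑ l ∈ Finset.range n, g ^ l) := by
      have h3 := mul_neg_geom_sum (1 - (M : ℝ) * δ) n
      rw [sub_sub_cancel] at h3
      calc (c : ℝ) ≤ M * δ * ∑ l ∈ Finset.range n, (1 - (M : ℝ) * δ) ^ l := by rw [h3]; exact hc
        _ = δ * (M * ∑ l ∈ Finset.range n, (1 - (M : ℝ) * δ) ^ l) := by ring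
        _ ≤ _ := by gcongr
    have h4 : δ * (M * ∑ l ∈ Finset.range n, condLaw μ X N s δ y {0} ^ l)
        = ENNReal.ofReal (δ * (M * ∑ l ∈ Finset.range n, g ^ l)) := by
      rw [ENNReal.ofReal_mul (by positivity), ENNReal.ofReal_mul (by positivity),
        ENNReal.ofReal_sum_of_nonneg (fun _ _ => by positivity), hg']
      simp [ENNReal.ofReal_pow hg0]
    rw [h4, ← ENNReal.ofReal_coe_nnreal]
    exact ENNReal.ofReal_le_ofReal h2
  calc (c : ℝ≥0∞) * K
      ≤ δ * (M * ∑ l ∈ Finset.range n, condLaw μ X N s δ y {0} ^ l) * K := by gcongr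
    _ = δ * (M * (K * ∑ l ∈ Finset.range n, condLaw μ X N s δ y {0} ^ l)) := by ring
    _ ≤ _ := by gcongr

lemma setLIntegral_increment_le (hX : IsMarkovCountingSystem μ X N)
    (hhom : IsTimeHomogeneous μ X N) (hlam : HasRateFunction μ X N lam)
    {t s δ : ℝ≥0} (hts : t ≤ s) {x : ζ → ℤ} {A : Set Ω} (hA : MeasurableSet[history X N s] A)
    {F : (Transition ζ → ℕ) → ℝ≥0∞} (hF : F 0 = 0) {G : Ω → ℝ≥0∞}
    {n : ℕ} (hG : ∀ l < n, ∀ ω, F (increment N (s + l * δ) δ ω) ≤ G ω)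
    {S : Set (ζ → ℤ)} {M : (ζ → ℤ) → ℝ≥0} {c : ℝ≥0} (hM : ∀ y ∈ S, lam y ≤ M y)
    (hMδ : ∀ y ∈ S, M y * δ ≤ 1) (hc : ∀ y ∈ S, (c : ℝ) ≤ 1 - (1 - M y * δ) ^ n) :
    c * ∫⁻ ω in A, (X s ⁻¹' S).indicator (fun ω => F (increment N s δ ω)) ω ∂(μ[|X t ⁻¹' {x}])
      ≤ δ * ∫⁻ ω in A, (X s ⁻¹' S).indicator (fun ω => M (X s ω) * G ω) ω
        ∂(μ[|X t ⁻¹' {x}]) := by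
  have hXs : ∀ y, MeasurableSet[history X N s] (X s ⁻¹' {y}) := fun y =>
    measurable_state_history le_rfl (measurableSet_singleton y)
  have hAm : ∀ y, MeasurableSet (A ∩ X s ⁻¹' {y}) := fun y =>
    hX.history_le s _ (hA.inter (hXs y))
  have hU : A = ⋃ y, A ∩ X s ⁻¹' {y} := by ext; simp
  have hd : Pairwise (Function.onFun Disjoint fun y => A ∩ X s ⁻¹' {y}) := by
    intro y z hyz
    refine Set.disjoint_left.2 fun ω h1 h2 => hyz ?_
    exact h1.2.symm.trans h2.2
  rw [hU, lintegral_iUnion hAm hd, lintegral_iUnion hAm hd, ← ENNReal.tsum_mul_left,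
    ← ENNReal.tsum_mul_left]
  refine ENNReal.tsum_le_tsum fun y => ?_
  by_cases hy : y ∈ S
  · have e1 : ∫⁻ ω in A ∩ X s ⁻¹' {y}, (X s ⁻¹' S).indicator
        (fun ω => F (increment N s δ ω)) ω ∂(μ[|X t ⁻¹' {x}])
        = ∫⁻ ω in A ∩ X s ⁻¹' {y}, F (increment N s δ ω) ∂(μ[|X t ⁻¹' {x}]) := by
      refine setLIntegral_congr_fun (hAm y) fun ω hω => ?_
      have : X s ω = y := hω.2
      simp [this, hy]
    have e2 : ∫⁻ ω in A ∩ X s ⁻¹' {y}, (X s ⁻¹' S).indicator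
        (fun ω => M (X s ω) * G ω) ω ∂(μ[|X t ⁻¹' {x}])
        = M y * ∫⁻ ω in A ∩ X s ⁻¹' {y}, G ω ∂(μ[|X t ⁻¹' {x}]) := by
      rw [← lintegral_const_mul' _ _ ENNReal.coe_ne_top]
      refine setLIntegral_congr_fun (hAm y) fun ω hω => ?_
      have : X s ω = y := hω.2
      simp [this, hy]
    rw [e1, e2]
    exact setLIntegral_increment_le_of_subset hX hhom hlam hts (hA.inter (hXs y))
      inter_subset_right hF hG (hM y hy) (hMδ y hy) (hc y hy)
  · have e1 : ∫⁻ ω in A ∩ X s ⁻¹' {y}, (X s ⁻¹' S).indicator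
        (fun ω => F (increment N s δ ω)) ω ∂(μ[|X t ⁻¹' {x}])
        = ∫⁻ ω in A ∩ X s ⁻¹' {y}, 0 ∂(μ[|X t ⁻¹' {x}]) := by
      refine setLIntegral_congr_fun (hAm y) fun ω hω => ?_
      have : X s ω = y := hω.2
      simp [this, hy]
    rw [e1]; simp

/-- Comparison of an increment over one cell with the largest increment over the next `n` cells,
with a weight that is known at the start of the cell. -/
lemma lintegral_increment_mul_le (hX : IsMarkovCountingSystem μ X N)
    (hhom : IsTimeHomogeneous μ X N) (hlam : HasRateFunction μ X N lam)
    {t s δ : ℝ≥0} (hts : t ≤ s) {x : ζ → ℤ}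
    {F : (Transition ζ → ℕ) → ℝ≥0∞} (hF : F 0 = 0) {G : Ω → ℝ≥0∞} (hGm : Measurable G)
    {n : ℕ} (hG : ∀ l < n, ∀ ω, F (increment N (s + l * δ) δ ω) ≤ G ω)
    {S : Set (ζ → ℤ)} {M : (ζ → ℤ) → ℝ≥0} {c : ℝ≥0} (hM : ∀ y ∈ S, lam y ≤ M y)
    (hMδ : ∀ y ∈ S, M y * δ ≤ 1) (hc : ∀ y ∈ S, (c : ℝ) ≤ 1 - (1 - M y * δ) ^ n)
    {u : Ω → ℝ≥0∞} (hu : Measurable[history X N s] u) :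
    c * ∫⁻ ω, (X s ⁻¹' S).indicator (fun ω => F (increment N s δ ω)) ω * u ω ∂(μ[|X t ⁻¹' {x}])
      ≤ δ * ∫⁻ ω, (X s ⁻¹' S).indicator (fun ω => M (X s ω) * G ω) ω * u ω
        ∂(μ[|X t ⁻¹' {x}]) := by
  have hS : MeasurableSet (X s ⁻¹' S) := hX.measurable_state s S.to_countable.measurableSet
  have hf : Measurable ((X s ⁻¹' S).indicator (fun ω => F (increment N s δ ω))) :=
    ((measurable_of_countable F).comp (hX.measurable_increment s δ)).indicator hS
  have hg : Measurable ((X s ⁻¹' S).indicator (fun ω => M (X s ω) * G ω)) := by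
    refine Measurable.indicator (Measurable.mul ?_ hGm) hS
    exact (measurable_of_countable fun y => (M y : ℝ≥0∞)).comp (hX.measurable_state s)
  have := lintegral_mul_le_of_setLIntegral_le (hX.history_le s) (P := μ[|X t ⁻¹' {x}])
    (hf.const_mul (c : ℝ≥0∞)) (hg.const_mul (δ : ℝ≥0∞)) hu fun A hA => by
      rw [lintegral_const_mul' _ _ ENNReal.coe_ne_top, lintegral_const_mul' _ _ ENNReal.coe_ne_top]
      exact setLIntegral_increment_le hX hhom hlam hts hA hF hG hM hMδ hc
  simpa only [mul_assoc, lintegral_const_mul' _ _ ENNReal.coe_ne_top] using this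

end FirstEvent

lemma measurable_indicator_one {Ω : Type*} {m : MeasurableSpace Ω} {s : Set Ω}
    (hs : MeasurableSet s) : Measurable (s.indicator fun _ => (1 : ℝ≥0∞)) :=
  measurable_const.indicator hs

lemma measurable_finset_sup {Ω ι α : Type*} [MeasurableSpace Ω] [SemilatticeSup α] [OrderBot α]
    [MeasurableSpace α] [MeasurableSup₂ α] (s : Finset ι) {f : ι → Ω → α}
    (hf : ∀ i ∈ s, Measurable (f i)) : Measurable fun ω => s.sup fun i => f i ω := by
  classical
  induction s using Finset.induction_on with
  | empty => simp
  | insert i s _ ih =>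
    simp only [Finset.sup_insert]
    exact (hf i (Finset.mem_insert_self i s)).sup
      (ih fun j hj => hf j (Finset.mem_insert_of_mem hj))

lemma lintegral_mul_indicator_one {Ω : Type*} [MeasurableSpace Ω] {P : Measure Ω} {S : Set Ω}
    (hS : MeasurableSet S) (f : Ω → ℝ≥0∞) :
    ∫⁻ ω, f ω * S.indicator (fun _ => 1) ω ∂P = ∫⁻ ω in S, f ω ∂P := by
  rw [← lintegral_indicator hS]
  refine lintegral_congr fun ω => ?_
  by_cases h : ω ∈ S <;> simp [h]

section Grid

variable {ζ Ω : Type*}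

/-- The increment of `N_p`, truncated at `K`, over the cell number `j` of the grid on `[t, ∞)` with
mesh `δ`, discarded if the rate at the start of the cell exceeds `K`. -/
noncomputable def cellIncrement (X : ℝ≥0 → Ω → ζ → ℤ) (N : Transition ζ → ℝ≥0 → Ω → ℕ)
    (lam : (ζ → ℤ) → ℝ≥0) (p : Transition ζ) (t δ : ℝ≥0) (K j : ℕ) (ω : Ω) : ℕ :=
  if lam (X (t + j * δ) ω) ≤ K then min (increment N (t + j * δ) δ ω p) K else 0

/-- The sum of the truncated increments over the first `n` cells. -/
noncomputable def gridIncrement (X : ℝ≥0 → Ω → ζ → ℤ) (N : Transition ζ → ℝ≥0 → Ω → ℕ)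
    (lam : (ζ → ℤ) → ℝ≥0) (p : Transition ζ) (t δ : ℝ≥0) (K n : ℕ) (ω : Ω) : ℕ :=
  ∑ j ∈ Finset.range n, cellIncrement X N lam p t δ K j ω

/-- The largest truncated increment of `N_p` over one of the first `n` cells. -/
def gridJump (N : Transition ζ → ℝ≥0 → Ω → ℕ) (p : Transition ζ) (t δ : ℝ≥0) (K n : ℕ) (ω : Ω) :
    ℕ :=
  (Finset.range n).sup fun j => min (increment N (t + j * δ) δ ω p) K

/-- The largest rate not exceeding `K` at the start of one of the first `n` cells, and at
least `a`. -/
noncomputable def gridRate (X : ℝ≥0 → Ω → ζ → ℤ) (lam : (ζ → ℤ) → ℝ≥0) (a t δ : ℝ≥0) (K n : ℕ)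
    (ω : Ω) : ℝ≥0 :=
  (Finset.range n).sup fun j =>
    if lam (X (t + j * δ) ω) ≤ K then max a (lam (X (t + j * δ) ω)) else 0

variable {X : ℝ≥0 → Ω → ζ → ℤ} {N : Transition ζ → ℝ≥0 → Ω → ℕ} {lam : (ζ → ℤ) → ℝ≥0}
  {p : Transition ζ}

lemma measurable_cellIncrement_history [Finite ζ] {t δ u : ℝ≥0} {K j : ℕ}
    (hu : t + (j + 1) * δ ≤ u) :
    Measurable[history X N u] (cellIncrement X N lam p t δ K j) := by
  have h1 : Measurable[history X N u] (X (t + j * δ)) :=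
    measurable_state_history (le_trans (by gcongr; simp) hu)
  have h2 : Measurable[history X N u] (increment N (t + j * δ) δ) :=
    measurable_increment_history (le_trans (by rw [add_assoc, add_mul, one_mul]) hu)
  have := Fintype.ofFinite ζ
  generalize history X N u = m at h1 h2
  exact (measurable_of_countable fun a : (ζ → ℤ) × (Transition ζ → ℕ) =>
    if lam a.1 ≤ K then min (a.2 p) K else 0).comp (h1.prodMk h2)

lemma measurable_gridIncrement_history [Finite ζ] {t δ u : ℝ≥0} {K n : ℕ}
    (hu : t + n * δ ≤ u) : Measurable[history X N u] (gridIncrement X N lam p t δ K n) := by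
  refine @Finset.measurable_fun_sum _ _ _ _ _ _ (history X N u) _ _ fun j hj =>
    measurable_cellIncrement_history (le_trans ?_ hu)
  have : ((j : ℝ≥0) + 1) ≤ n := by exact_mod_cast Finset.mem_range.1 hj
  gcongr

lemma gridIncrement_mono {t δ : ℝ≥0} {K : ℕ} (ω : Ω) :
    Monotone fun n => gridIncrement X N lam p t δ K n ω := fun _ _ h =>
  Finset.sum_le_sum_of_subset (Finset.range_mono h)

lemma le_gridJump {t δ : ℝ≥0} {K n j : ℕ} (hj : j < n) (ω : Ω) :
    min (increment N (t + j * δ) δ ω p) K ≤ gridJump N p t δ K n ω :=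
  Finset.le_sup (f := fun j : ℕ => min (increment N (t + j * δ) δ ω p) K) (Finset.mem_range.2 hj)

lemma gridJump_le {t δ : ℝ≥0} {K n : ℕ} (ω : Ω) : gridJump N p t δ K n ω ≤ K :=
  Finset.sup_le fun _ _ => min_le_right _ _

lemma le_gridRate {a t δ : ℝ≥0} {K n j : ℕ} (hj : j < n) {ω : Ω}
    (h : lam (X (t + j * δ) ω) ≤ K) :
    max a (lam (X (t + j * δ) ω)) ≤ gridRate X lam a t δ K n ω := by
  refine le_trans ?_ (Finset.le_sup (f := fun j : ℕ =>
    if lam (X (t + j * δ) ω) ≤ K then max a (lam (X (t + j * δ) ω)) else 0)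
    (Finset.mem_range.2 hj))
  simp [h]

lemma gridRate_le {a t δ : ℝ≥0} {K n : ℕ} (ω : Ω) : gridRate X lam a t δ K n ω ≤ max a K := by
  refine Finset.sup_le fun j _ => ?_
  split_ifs with h
  · exact max_le_max le_rfl h
  · exact zero_le

lemma gridRate_eq_zero_or_le {a t δ : ℝ≥0} {K n : ℕ} (ω : Ω) :
    gridRate X lam a t δ K n ω = 0 ∨ a ≤ gridRate X lam a t δ K n ω := by
  by_cases h : ∃ j < n, lam (X (t + j * δ) ω) ≤ K
  · obtain ⟨j, hj, h⟩ := h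
    exact Or.inr ((le_max_left _ _).trans (le_gridRate hj h))
  · push Not at h
    refine Or.inl (nonpos_iff_eq_zero.1 (Finset.sup_le fun j hj => ?_))
    rw [if_neg (not_le.2 (h j (Finset.mem_range.1 hj)))]

variable [Fintype ζ] [DecidableEq ζ] [MeasurableSpace Ω] {μ : Measure Ω}

namespace IsMarkovCountingSystem

lemma measurable_cellIncrement (hX : IsMarkovCountingSystem μ X N) (t δ : ℝ≥0) (K j : ℕ) :
    Measurable (cellIncrement X N lam p t δ K j) :=
  (measurable_cellIncrement_history le_rfl).mono (hX.history_le _) le_rfl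

lemma measurable_gridIncrement (hX : IsMarkovCountingSystem μ X N) (t δ : ℝ≥0) (K n : ℕ) :
    Measurable (gridIncrement X N lam p t δ K n) :=
  (measurable_gridIncrement_history le_rfl).mono (hX.history_le _) le_rfl

lemma measurable_gridJump (hX : IsMarkovCountingSystem μ X N) (t δ : ℝ≥0) (K n : ℕ) :
    Measurable (gridJump N p t δ K n) := by
  refine measurable_finset_sup _ fun j _ => ?_
  exact (measurable_of_countable fun a : Transition ζ → ℕ => min (a p) K).comp
    (hX.measurable_increment _ _)

lemma measurable_gridRate (hX : IsMarkovCountingSystem μ X N) (a t δ : ℝ≥0) (K n : ℕ) :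
    Measurable (gridRate X lam a t δ K n) := by
  refine measurable_finset_sup _ fun j _ => ?_
  exact (measurable_of_countable fun y : ζ → ℤ => if lam y ≤ K then max a (lam y) else 0).comp
    (hX.measurable_state _)

lemma sum_increment (hX : IsMarkovCountingSystem μ X N) (t δ : ℝ≥0) (n : ℕ) (ω : Ω) :
    ∑ j ∈ Finset.range n, increment N (t + j * δ) δ ω p = increment N t (n * δ) ω p := by
  induction n with
  | zero => simp [increment]
  | succ n ih =>
    rw [Finset.sum_range_succ, ih, Nat.cast_succ, add_mul, one_mul, hX.increment_add]; rfl

lemma le_gridIncrement (hX : IsMarkovCountingSystem μ X N) {t δ : ℝ≥0} {K n : ℕ} {ω : Ω}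
    (hK : increment N t (n * δ) ω p ≤ K) (hr : ∀ s ∈ Icc t (t + n * δ), lam (X s ω) ≤ K) :
    increment N t (n * δ) ω p ≤ gridIncrement X N lam p t δ K n ω := by
  conv_lhs => rw [← hX.sum_increment]
  refine Finset.sum_le_sum fun j hj => ?_
  have hj' : ((j : ℝ≥0) + 1) ≤ n := by exact_mod_cast Finset.mem_range.1 hj
  have h1 : t + j * δ + δ ≤ t + n * δ := by
    rw [add_assoc]
    gcongr
    calc _ = ((j : ℝ≥0) + 1) * δ := by ring
      _ ≤ _ := by gcongr
  have h2 := hX.increment_mono (t := t) (s := t + j * δ) le_self_add h1 ω p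
  rw [cellIncrement, if_pos (hr _ ⟨le_self_add, le_self_add.trans h1⟩), min_eq_left (h2.trans hK)]

end IsMarkovCountingSystem

variable [IsProbabilityMeasure μ]

lemma lintegral_cellIncrement_mul_le (hX : IsMarkovCountingSystem μ X N)
    (hhom : IsTimeHomogeneous μ X N) (hlam : HasRateFunction μ X N lam) {t δ a c : ℝ≥0}
    {x : ζ → ℤ} {K n m j k : ℕ} (hk : k ≠ 0) (hj : j < n) (hδ : max a K * δ ≤ 1)
    (hc : (c : ℝ) ≤ 1 - (1 - a * δ) ^ m) {u : Ω → ℝ≥0∞}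
    (hu : Measurable[history X N (t + j * δ)] u) :
    c * ∫⁻ ω, (cellIncrement X N lam p t δ K j ω : ℝ≥0∞) ^ k * u ω ∂(μ[|X t ⁻¹' {x}])
      ≤ δ * ∫⁻ ω, gridRate X lam a t δ K n ω * (gridJump N p t δ K (n + m) ω : ℝ≥0∞) ^ k * u ω
        ∂(μ[|X t ⁻¹' {x}]) := by
  have h := lintegral_increment_mul_le hX hhom hlam (t := t) (s := t + j * δ) le_self_add (x := x)
    (δ := δ) (F := fun ν => ((min (ν p) K : ℕ) : ℝ≥0∞) ^ k) (by simp [hk])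
    (G := fun ω => (gridJump N p t δ K (n + m) ω : ℝ≥0∞) ^ k)
    (((measurable_of_countable fun i : ℕ => (i : ℝ≥0∞) ^ k)).comp
      (hX.measurable_gridJump t δ K (n + m))) (n := m) (fun l hl ω => by
        have := le_gridJump (N := N) (p := p) (t := t) (δ := δ) (K := K) (n := n + m) (j := j + l)
          (by omega) ω
        rw [show t + j * δ + l * δ = t + ((j + l : ℕ) : ℝ≥0) * δ by push_cast; ring]
        exact pow_le_pow_left₀ zero_le (by exact_mod_cast this) k)
    (S := {y | lam y ≤ K}) (M := fun y => max a (lam y)) (c := c) (fun y _ => le_max_right _ _)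
    (fun y hy => le_trans (mul_le_mul_left (max_le_max le_rfl hy) δ) hδ) (fun y hy => by
      refine hc.trans (sub_le_sub_left ?_ _)
      have h1 : max a (lam y) * δ ≤ 1 := le_trans (mul_le_mul_left (max_le_max le_rfl hy) δ) hδ
      have h2 : ((max a (lam y) : ℝ≥0) : ℝ) * δ ≤ 1 := by exact_mod_cast h1
      have h3 : (a : ℝ) ≤ (max a (lam y) : ℝ≥0) := by exact_mod_cast le_max_left _ _
      refine pow_le_pow_left₀ (by linarith) ?_ m
      gcongr) hu
  refine le_trans (le_of_eq ?_) (h.trans ?_)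
  · congr 1
    refine lintegral_congr fun ω => ?_
    by_cases hω : lam (X (t + j * δ) ω) ≤ K <;> simp [cellIncrement, hω, hk]
  · gcongr with ω
    by_cases hω : lam (X (t + j * δ) ω) ≤ K
    · rw [indicator_of_mem (show ω ∈ X (t + j * δ) ⁻¹' {y | lam y ≤ K} from hω)]
      gcongr
      exact le_gridRate hj hω
    · rw [indicator_of_notMem (show ω ∉ X (t + j * δ) ⁻¹' {y | lam y ≤ K} from hω)]
      exact zero_le

/-- Moments of the truncated increments over single cells. -/
lemma sum_lintegral_cellIncrement_le (hX : IsMarkovCountingSystem μ X N)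
    (hhom : IsTimeHomogeneous μ X N) (hlam : HasRateFunction μ X N lam) {t δ a c : ℝ≥0}
    {x : ζ → ℤ} (hx : μ (X t ⁻¹' {x}) ≠ 0) {K n m k : ℕ} (hk : k ≠ 0) (hδ : max a K * δ ≤ 1)
    (hc : (c : ℝ) ≤ 1 - (1 - a * δ) ^ m) :
    c * ∑ j ∈ Finset.range n,
        ∫⁻ ω, (cellIncrement X N lam p t δ K j ω : ℝ≥0∞) ^ k ∂(μ[|X t ⁻¹' {x}])
      ≤ c * (n * ∫⁻ ω, ((min (increment N t δ ω p) K : ℕ) : ℝ≥0∞) ^ k ∂(μ[|X t ⁻¹' {x}]))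
        + n * δ * ∫⁻ ω in {ω | increment N t (n * δ) ω ≠ 0},
          gridRate X lam a t δ K n ω * (gridJump N p t δ K (n + m) ω : ℝ≥0∞) ^ k
            ∂(μ[|X t ⁻¹' {x}]) := by
  set P := μ[|X t ⁻¹' {x}] with hP
  have hPprob : IsProbabilityMeasure P := cond_isProbabilityMeasure hx
  have hXt : MeasurableSet (X t ⁻¹' {x}) := hX.measurable_state t (measurableSet_singleton x)
  set H : Ω → ℝ≥0∞ := fun ω =>
    gridRate X lam a t δ K n ω * (gridJump N p t δ K (n + m) ω : ℝ≥0∞) ^ k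
  set D := {ω | increment N t (n * δ) ω ≠ 0} with hD
  have hDm : MeasurableSet D :=
    (hX.measurable_increment t (n * δ) (measurableSet_singleton 0)).compl
  set F : (Transition ζ → ℕ) → ℝ≥0∞ := fun ν => ((min (ν p) K : ℕ) : ℝ≥0∞) ^ k
  have hcell : ∀ j < n, c * ∫⁻ ω, (cellIncrement X N lam p t δ K j ω : ℝ≥0∞) ^ k ∂P
      ≤ c * ∫⁻ ω, F (increment N t δ ω) ∂P + δ * ∫⁻ ω in D, H ω ∂P := by
    intro j hj
    set s := t + j * δ with hs
    have hmx : MeasurableSet[history X N s] (X s ⁻¹' {x}) :=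
      measurable_state_history le_rfl (measurableSet_singleton x)
    have hmx' := hX.history_le s _ hmx
    have h1 : ∫⁻ ω in X s ⁻¹' {x}, (cellIncrement X N lam p t δ K j ω : ℝ≥0∞) ^ k ∂P
        ≤ ∫⁻ ω, F (increment N t δ ω) ∂P := by
      calc _ ≤ ∫⁻ ω in X s ⁻¹' {x}, F (increment N s δ ω) ∂P := by
            refine lintegral_mono fun ω => ?_
            refine pow_le_pow_left₀ zero_le (Nat.cast_le.2 ?_) k
            rw [cellIncrement]; split_ifs
            · exact le_rfl
            · exact Nat.zero_le _
        _ = P (X s ⁻¹' {x}) * ∫⁻ ν, F ν ∂(condLaw μ X N t δ x) :=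
            setLIntegral_increment hX hhom δ le_self_add hx hmx subset_rfl F
        _ ≤ 1 * ∫⁻ ν, F ν ∂(condLaw μ X N t δ x) := by gcongr; exact prob_le_one
        _ = _ := by rw [one_mul, condLaw, lintegral_map (measurable_of_countable F)
                      (hX.measurable_increment t δ)]
    have h2 : c * ∫⁻ ω in (X s ⁻¹' {x})ᶜ, (cellIncrement X N lam p t δ K j ω : ℝ≥0∞) ^ k ∂P
        ≤ δ * ∫⁻ ω in D, H ω ∂P := by
      have h3 := lintegral_cellIncrement_mul_le hX hhom hlam (p := p) (x := x) (n := n) hk hj hδ hc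
        (u := (X s ⁻¹' {x})ᶜ.indicator fun _ => 1)
        (measurable_indicator_one hmx.compl)
      rw [lintegral_mul_indicator_one hmx'.compl, lintegral_mul_indicator_one hmx'.compl H] at h3
      refine h3.trans (mul_le_mul' le_rfl ?_)
      rw [← lintegral_indicator hDm, ← lintegral_indicator hmx'.compl]
      have hae : ∀ᵐ ω ∂P, ω ∈ X t ⁻¹' {x} := ae_cond_mem hXt
      refine lintegral_mono_ae (hae.mono fun ω hω => ?_)
      by_cases hs' : ω ∈ (X s ⁻¹' {x})ᶜ
      · have hωD : ω ∈ D := fun h0 => hs' <| by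
          have h4 : increment N t (j * δ) ω = 0 := by
            have h5 := hX.increment_mono (t := t) (s := t) (a := j * δ) (b := n * δ) le_rfl
              (by gcongr) ω
            rw [h0] at h5
            exact le_antisymm h5 zero_le
          exact (hX.state_eq_of_increment_eq_zero h4).trans hω
        rw [indicator_of_mem hs', indicator_of_mem hωD]
      · rw [indicator_of_notMem hs']
        exact zero_le
    calc _ = c * (∫⁻ ω in X s ⁻¹' {x}, (cellIncrement X N lam p t δ K j ω : ℝ≥0∞) ^ k ∂P
          + ∫⁻ ω in (X s ⁻¹' {x})ᶜ, (cellIncrement X N lam p t δ K j ω : ℝ≥0∞) ^ k ∂P) := by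
            rw [lintegral_add_compl _ hmx']
      _ ≤ _ := by rw [mul_add]; gcongr
  calc _ = ∑ j ∈ Finset.range n,
        c * ∫⁻ ω, (cellIncrement X N lam p t δ K j ω : ℝ≥0∞) ^ k ∂P := Finset.mul_sum _ _ _
    _ ≤ ∑ j ∈ Finset.range n,
        (c * ∫⁻ ω, F (increment N t δ ω) ∂P + δ * ∫⁻ ω in D, H ω ∂P) :=
        Finset.sum_le_sum fun j hj => hcell j (Finset.mem_range.1 hj)
    _ = _ := by rw [Finset.sum_const, Finset.card_range, nsmul_eq_mul]; ring

/-- Second moment of the sum of the truncated increments. -/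
lemma lintegral_gridIncrement_sq_le (hX : IsMarkovCountingSystem μ X N)
    (hhom : IsTimeHomogeneous μ X N) (hlam : HasRateFunction μ X N lam) {t δ a c : ℝ≥0}
    {x : ζ → ℤ} {K n m : ℕ} (hδ : max a K * δ ≤ 1)
    (hc : (c : ℝ) ≤ 1 - (1 - a * δ) ^ m) :
    c * ∫⁻ ω, (gridIncrement X N lam p t δ K n ω : ℝ≥0∞) ^ 2 ∂(μ[|X t ⁻¹' {x}])
      ≤ c * ∑ j ∈ Finset.range n,
          ∫⁻ ω, (cellIncrement X N lam p t δ K j ω : ℝ≥0∞) ^ 2 ∂(μ[|X t ⁻¹' {x}])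
        + 2 * (n * δ) * ∫⁻ ω, gridRate X lam a t δ K n ω * (gridJump N p t δ K (n + m) ω : ℝ≥0∞)
          * gridIncrement X N lam p t δ K n ω ∂(μ[|X t ⁻¹' {x}]) := by
  set P := μ[|X t ⁻¹' {x}]
  set I := ∫⁻ ω, gridRate X lam a t δ K n ω * (gridJump N p t δ K (n + m) ω : ℝ≥0∞)
          * gridIncrement X N lam p t δ K n ω ∂P with hI
  have key : ∀ i ≤ n, c * ∫⁻ ω, (gridIncrement X N lam p t δ K i ω : ℝ≥0∞) ^ 2 ∂P
      ≤ c * ∑ j ∈ Finset.range i,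
          ∫⁻ ω, (cellIncrement X N lam p t δ K j ω : ℝ≥0∞) ^ 2 ∂P + 2 * (i * δ) * I := by
    intro i
    induction i with
    | zero => intro _; simp [gridIncrement]
    | succ i ih =>
      intro hi
      specialize ih (by omega)
      have hcast : ∀ f : Ω → ℕ, Measurable f → Measurable fun ω => (f ω : ℝ≥0∞) := fun f hf =>
        (measurable_of_countable (fun n : ℕ => (n : ℝ≥0∞))).comp hf
      have hg := hcast _ (hX.measurable_gridIncrement (lam := lam) (p := p) t δ K i)
      have hw := hcast _ (hX.measurable_cellIncrement (lam := lam) (p := p) t δ K i)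
      have hmg : Measurable[history X N (t + i * δ)]
          fun ω => (gridIncrement X N lam p t δ K i ω : ℝ≥0∞) := by
        have := measurable_gridIncrement_history (X := X) (N := N) (lam := lam) (p := p) (t := t)
          (δ := δ) (K := K) (n := i) le_rfl
        exact @Measurable.comp _ _ _ (history X N (t + i * δ)) _ _ _ _
          (measurable_of_countable (fun n : ℕ => (n : ℝ≥0∞))) this
      have hcross := lintegral_cellIncrement_mul_le hX hhom hlam (p := p) (x := x) (n := n) (K := K)
        (j := i) one_ne_zero (by omega) hδ hc hmg
      simp only [pow_one] at hcross
      have hle : ∫⁻ ω, gridRate X lam a t δ K n ω * (gridJump N p t δ K (n + m) ω : ℝ≥0∞)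
          * gridIncrement X N lam p t δ K i ω ∂P ≤ I := by
        refine lintegral_mono fun ω => ?_
        have := gridIncrement_mono (X := X) (N := N) (lam := lam) (p := p) (t := t) (δ := δ)
          (K := K) ω (show i ≤ n by omega)
        gcongr
      have hexp : ∀ ω, (gridIncrement X N lam p t δ K (i + 1) ω : ℝ≥0∞) ^ 2
          = (gridIncrement X N lam p t δ K i ω : ℝ≥0∞) ^ 2
            + ((cellIncrement X N lam p t δ K i ω : ℝ≥0∞) ^ 2
            + 2 * (cellIncrement X N lam p t δ K i ω * gridIncrement X N lam p t δ K i ω)) := by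
        intro ω
        rw [gridIncrement, Finset.sum_range_succ]
        simp only [gridIncrement]
        push_cast
        ring
      simp_rw [hexp]
      rw [lintegral_add_left (hg.pow_const 2), lintegral_add_left (hw.pow_const 2),
        lintegral_const_mul' _ _ ENNReal.ofNat_ne_top, Finset.sum_range_succ]
      calc _ = c * ∫⁻ ω, (gridIncrement X N lam p t δ K i ω : ℝ≥0∞) ^ 2 ∂P
            + c * ∫⁻ ω, (cellIncrement X N lam p t δ K i ω : ℝ≥0∞) ^ 2 ∂P
            + 2 * (c * ∫⁻ ω, (cellIncrement X N lam p t δ K i ω : ℝ≥0∞)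
              * gridIncrement X N lam p t δ K i ω ∂P) := by ring
        _ ≤ (c * ∑ j ∈ Finset.range i,
              ∫⁻ ω, (cellIncrement X N lam p t δ K j ω : ℝ≥0∞) ^ 2 ∂P + 2 * (i * δ) * I)
            + c * ∫⁻ ω, (cellIncrement X N lam p t δ K i ω : ℝ≥0∞) ^ 2 ∂P
            + 2 * (δ * I) := by
              exact add_le_add (add_le_add ih le_rfl)
                (mul_le_mul' le_rfl (hcross.trans (mul_le_mul' le_rfl hle)))
        _ = _ := by push_cast; ring
  exact key n le_rfl

end Grid

section StepPaths

/-- A nondecreasing right-continuous step function increases over short intervals by at most one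
of its jumps. -/
lemma exists_increment_le_jump {f : ℝ≥0 → ℕ} (hf : Monotone f)
    (hr : ∀ s, ContinuousWithinAt f (Ici s) s) (a b : ℝ≥0) :
    ∃ ε : ℝ, 0 < ε ∧ ∀ u ∈ Icc a b, ∀ v, dist v u < ε →
      ∃ s ∈ Icc a b, f v - f u ≤ f s - Function.leftLim f s := by
  have hloc : ∀ s, ∀ᶠ u in 𝓝 s, Function.leftLim f s ≤ f u ∧ f u ≤ f s := by
    intro s
    rw [← nhdsLT_sup_nhdsGE s, eventually_sup]
    constructor
    · have h1 : ∀ᶠ u in 𝓝[<] s, f u = Function.leftLim f s := by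
        have := hf.tendsto_leftLim s
        rw [nhds_discrete] at this
        exact tendsto_pure.1 this
      filter_upwards [h1, self_mem_nhdsWithin] with u hu hus
      exact ⟨hu.ge, hf (le_of_lt hus)⟩
    · have h1 : ∀ᶠ u in 𝓝[≥] s, f u = f s := by
        have := hr s
        rw [ContinuousWithinAt, nhds_discrete] at this
        exact tendsto_pure.1 this
      filter_upwards [h1, self_mem_nhdsWithin] with u hu hus
      exact ⟨hf.leftLim_le hus, hu.le⟩
  choose U hU hUo hUs using fun s => eventually_nhds_iff.1 (hloc s)
  obtain ⟨ε, hε, h⟩ := lebesgue_number_lemma_of_metric (c := fun s : Icc a b => U s)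
    (isCompact_Icc (a := a) (b := b)) (fun s => hUo s)
    (fun s hs => mem_iUnion.2 ⟨⟨s, hs⟩, hUs s⟩)
  refine ⟨ε, hε, fun u hu v hv => ?_⟩
  obtain ⟨s, hs⟩ := h u hu
  have h1 := hU s u (hs (Metric.mem_ball_self hε))
  have h2 := hU s v (hs hv)
  exact ⟨s, s.2, by omega⟩

variable {ζ Ω : Type*} {X : ℝ≥0 → Ω → ζ → ℤ} {N : Transition ζ → ℝ≥0 → Ω → ℕ}
  {lam : (ζ → ℤ) → ℝ≥0} {p : Transition ζ}

lemma gridRate_le_rateBound {t δ hbar : ℝ≥0} {K n : ℕ} {ω : Ω} (h : n * δ ≤ hbar) :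
    (gridRate X lam (lam (X t ω)) t δ K n ω : ℝ≥0∞) ≤ rateBound X lam t hbar ω := by
  have hmem : ∀ s ∈ Icc t (t + hbar), (lam (X s ω) : ℝ≥0∞) ≤ rateBound X lam t hbar ω :=
    fun s hs => le_iSup₂ (f := fun s (_ : s ∈ Icc t (t + hbar)) => (lam (X s ω) : ℝ≥0∞)) s hs
  by_cases htop : rateBound X lam t hbar ω = ⊤
  · rw [htop]; exact le_top
  rw [← ENNReal.coe_toNNReal htop] at hmem ⊢
  simp only [ENNReal.coe_le_coe] at hmem ⊢
  refine Finset.sup_le fun j hj => ?_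
  split_ifs
  · refine max_le (hmem t ⟨le_rfl, le_self_add⟩) (hmem _ ⟨le_self_add, ?_⟩)
    gcongr
    refine le_trans ?_ h
    gcongr
    exact (Finset.mem_range.1 hj).le
  · exact zero_le

lemma eventually_gridJump_le [MeasurableSpace Ω] (hN : IsCountingProcess (N p)) {t hbar : ℝ≥0}
    {δ : ℕ → ℝ≥0} (hδ : Tendsto δ atTop (𝓝 0)) {K : ℕ} {m : ℕ → ℕ}
    (hm : ∀ n, m n * δ n ≤ hbar) (ω : Ω) :
    ∀ᶠ n in atTop, (gridJump N p t (δ n) K (m n) ω : ℝ≥0∞) ≤ jumpBound (N p) t hbar ω := by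
  obtain ⟨ε, hε, h⟩ := exists_increment_le_jump (hN.mono ω) (hN.right_continuous ω) t (t + hbar)
  have hev : ∀ᶠ n in atTop, (δ n : ℝ) < ε :=
    (NNReal.tendsto_coe.2 hδ).eventually (gt_mem_nhds (by simpa using hε))
  filter_upwards [hev] with n hn
  have hJ : ∀ j ∈ Finset.range (m n), ((min (increment N (t + j * δ n) (δ n) ω p) K : ℕ) : ℝ≥0∞)
      ≤ jumpBound (N p) t hbar ω := by
    intro j hj
    have hmem : t + j * δ n ∈ Icc t (t + hbar) := by
      refine ⟨le_self_add, ?_⟩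
      gcongr
      refine le_trans ?_ (hm n)
      gcongr
      exact (Finset.mem_range.1 hj).le
    obtain ⟨s, hs, hle⟩ := h _ hmem (t + j * δ n + δ n) (by
      rw [NNReal.dist_eq]; push_cast; simpa using hn)
    refine le_trans ?_ (le_iSup₂ (f := fun s (_ : s ∈ Icc t (t + hbar)) =>
      ((N p s ω - Function.leftLim (fun u => N p u ω) s : ℕ) : ℝ≥0∞)) s hs)
    exact_mod_cast (min_le_left _ _).trans hle
  unfold gridJump
  rcases (Finset.range (m n)).eq_empty_or_nonempty with he | hne
  · rw [he]; simp
  · obtain ⟨j, hj, e⟩ := Finset.exists_mem_eq_sup _ hne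
      fun j : ℕ => min (increment N (t + j * δ n) (δ n) ω p) K
    rw [e]; exact hJ j hj

variable [Fintype ζ] [DecidableEq ζ] [MeasurableSpace Ω] {μ : Measure Ω}

lemma exists_rate_le (hX : IsMarkovCountingSystem μ X N) (t h : ℝ≥0) (ω : Ω) :
    ∃ K : ℕ, ∀ s ∈ Icc t (t + h), lam (X s ω) ≤ K := by
  set Φ : (Transition ζ → ℕ) → ζ → ℤ := fun ν c => X 0 ω c
      + ∑ p : Transition ζ with p.1.2 = c, (ν p : ℤ)
      - ∑ p : Transition ζ with p.1.1 = c, (ν p : ℤ)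
  have hΦ : ∀ s, X s ω = Φ fun p => N p s ω := fun s => funext (hX.mass_conservation s ω)
  have hfin := (Set.finite_Iic fun p => N p (t + h) ω).image fun ν => lam (Φ ν)
  obtain ⟨B, hB⟩ := hfin.bddAbove
  obtain ⟨K, hK⟩ := exists_nat_ge B
  refine ⟨K, fun s hs => le_trans (hB ⟨fun p => N p s ω, fun p => ?_, ?_⟩) hK⟩
  · exact (hX.counting p).mono ω hs.2
  · simp only [hΦ s]

lemma limsup_setLIntegral_le {P : Measure Ω} [IsFiniteMeasure P] {f : ℕ → Ω → ℝ≥0∞}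
    {g : Ω → ℝ≥0∞} (hf : ∀ n, Measurable (f n)) {B : ℝ≥0∞} (hB : B ≠ ∞) (hfB : ∀ n ω, f n ω ≤ B)
    (hfg : ∀ᵐ ω ∂P, ∀ᶠ n in atTop, f n ω ≤ g ω) (D : Set Ω) :
    limsup (fun n => ∫⁻ ω in D, f n ω ∂P) atTop ≤ ∫⁻ ω in D, g ω ∂P := by
  refine (limsup_lintegral_le (fun _ => B) hf (fun n => ae_of_all _ (hfB n)) ?_).trans ?_
  · rw [lintegral_const]
    exact ENNReal.mul_ne_top hB (measure_ne_top _ _)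
  · refine lintegral_mono_ae ((ae_restrict_of_ae hfg).mono fun ω hω => ?_)
    exact limsup_le_of_le (by isBoundedDefault) hω

end StepPaths

section LimitOfGrid

variable {ζ Ω : Type*} [Fintype ζ] [DecidableEq ζ] [MeasurableSpace Ω] {μ : Measure Ω}
  {X : ℝ≥0 → Ω → ζ → ℤ} {N : Transition ζ → ℝ≥0 → Ω → ℕ} {lam : (ζ → ℤ) → ℝ≥0}
  {p : Transition ζ}

/-- The product of the largest rate and the largest jump on grids of vanishing mesh is
asymptotically controlled by `jumpBound * rateBound`. -/
lemma limsup_setLIntegral_grid_le [IsProbabilityMeasure μ] (hX : IsMarkovCountingSystem μ X N)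
    {t hbar : ℝ≥0} {x : ζ → ℤ} (hx : μ (X t ⁻¹' {x}) ≠ 0) {δ : ℕ → ℝ≥0}
    (hδ : Tendsto δ atTop (𝓝 0)) {K : ℕ} {n m : ℕ → ℕ} (hn : ∀ i, n i * δ i ≤ hbar)
    (hm : ∀ i, m i * δ i ≤ hbar) (k : ℕ) (D : Set Ω) :
    limsup (fun i => ∫⁻ ω in D, (gridRate X lam (lam x) t (δ i) K (n i) ω
        * (gridJump N p t (δ i) K (m i) ω : ℝ≥0∞)) ^ k ∂(μ[|X t ⁻¹' {x}])) atTop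
      ≤ ∫⁻ ω in D, (jumpBound (N p) t hbar ω * rateBound X lam t hbar ω) ^ k
        ∂(μ[|X t ⁻¹' {x}]) := by
  have := cond_isProbabilityMeasure hx
  refine limsup_setLIntegral_le (B := (((max (lam x) K : ℝ≥0) : ℝ≥0∞) * K) ^ k) (fun i => ?_)
    (by finiteness) (fun i ω => ?_) ?_ D
  · have h1 : Measurable fun ω => (gridJump N p t (δ i) K (m i) ω : ℝ≥0∞) :=
      (measurable_of_countable (fun n : ℕ => (n : ℝ≥0∞))).comp (hX.measurable_gridJump _ _ _ _)
    exact (((hX.measurable_gridRate _ _ _ _ _).coe_nnreal_ennreal).mul h1).pow_const k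
  · gcongr
    · exact gridRate_le ω
    · exact gridJump_le ω
  · have hXt : MeasurableSet (X t ⁻¹' {x}) := hX.measurable_state t (measurableSet_singleton x)
    filter_upwards [ae_cond_mem hXt] with ω hω
    filter_upwards [eventually_gridJump_le (hX.counting p) hδ hm ω] with i hi
    have hω' : X t ω = x := hω
    rw [mul_comm (jumpBound _ _ _ _)]
    gcongr
    rw [← hω']
    exact gridRate_le_rateBound (hn i)

end LimitOfGrid

section InfinitesimalMoments

variable {ζ Ω : Type*}

/-- Exactly `k` events of type `p` and no other event occur in `(t, t + h]`. -/
def onlyEvent (N : Transition ζ → ℝ≥0 → Ω → ℕ) (t h : ℝ≥0) (a : Transition ζ × ℕ+) : Set Ω :=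
  {ω | increment N t h ω a.1 = a.2 ∧ ∀ p', p' ≠ a.1 → increment N t h ω p' = 0}

variable {N : Transition ζ → ℝ≥0 → Ω → ℕ} {p : Transition ζ}

lemma eq_of_mem_onlyEvent {t h : ℝ≥0} {a b : Transition ζ × ℕ+} {ω : Ω}
    (ha : ω ∈ onlyEvent N t h a) (hb : ω ∈ onlyEvent N t h b) : a = b := by
  have h1 : a.1 = b.1 := by
    by_contra hne
    have := hb.2 a.1 hne
    rw [ha.1] at this
    exact a.2.ne_zero this
  refine Prod.ext h1 (PNat.eq ?_)
  rw [← ha.1, ← hb.1, h1]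

lemma sum_indicator_onlyEvent_le {t h : ℝ≥0} (S : Finset (Transition ζ × ℕ+))
    (f : Transition ζ × ℕ+ → ℝ≥0∞) (ω : Ω) {B : ℝ≥0∞}
    (hB : ∀ a ∈ S, ω ∈ onlyEvent N t h a → f a ≤ B) :
    ∑ a ∈ S, (onlyEvent N t h a).indicator (fun _ => f a) ω ≤ B := by
  by_cases hex : ∃ a ∈ S, ω ∈ onlyEvent N t h a
  · obtain ⟨a, haS, ha⟩ := hex
    rw [Finset.sum_eq_single_of_mem a haS, indicator_of_mem ha]
    · exact hB a haS ha
    · exact fun b _ hba => indicator_of_notMem (fun hb => hba (eq_of_mem_onlyEvent hb ha)) _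
  · push Not at hex
    rw [Finset.sum_eq_zero fun a ha => indicator_of_notMem (hex a ha) _]
    exact zero_le

/-- Deterministic form of the comparison of truncated moments with the probabilities of the
events in a finite set. -/
lemma truncated_moment_le [DecidableEq (Transition ζ)] {t h : ℝ≥0} (K : ℕ) {k : ℕ} (hk : k ≠ 0)
    (S : Finset (Transition ζ × ℕ+)) (ω : Ω) :
    ∑ a ∈ S, (onlyEvent N t h a).indicator (fun _ => (K : ℝ≥0∞) ^ k) ω
        + ((min (increment N t h ω p) K : ℕ) : ℝ≥0∞) ^ k
      ≤ ∑ a ∈ S, (onlyEvent N t h a).indicator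
          (fun _ => if a.1 = p then ((a.2 : ℕ) : ℝ≥0∞) ^ k else 0) ω
        + {ω | increment N t h ω ≠ 0}.indicator (fun _ => (K : ℝ≥0∞) ^ k) ω := by
  have hKk : ((min (increment N t h ω p) K : ℕ) : ℝ≥0∞) ^ k ≤ (K : ℝ≥0∞) ^ k := by
    gcongr; exact min_le_right _ _
  by_cases h0 : increment N t h ω = 0
  · have h1 : ∀ a ∈ S, ω ∉ onlyEvent N t h a := fun a _ ha => by
      have := ha.1
      rw [h0] at this
      exact a.2.ne_zero this.symm
    rw [Finset.sum_eq_zero fun a ha => indicator_of_notMem (h1 a ha) _, h0]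
    simp [hk]
  · rw [indicator_of_mem (show ω ∈ {ω | increment N t h ω ≠ 0} from h0)]
    by_cases hex : ∃ a ∈ S, ω ∈ onlyEvent N t h a
    · obtain ⟨a, haS, ha⟩ := hex
      have h1 : ∀ b ∈ S, b ≠ a → ω ∉ onlyEvent N t h b := fun b _ hba hb =>
        hba (eq_of_mem_onlyEvent hb ha)
      rw [Finset.sum_eq_single_of_mem a haS fun b hb hba => indicator_of_notMem (h1 b hb hba) _,
        Finset.sum_eq_single_of_mem a haS fun b hb hba => indicator_of_notMem (h1 b hb hba) _,
        indicator_of_mem ha, indicator_of_mem ha, add_comm]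
      gcongr
      split_ifs with hap
      · rw [← ha.1, hap]
        gcongr
        exact min_le_left _ _
      · rw [ha.2 p (Ne.symm hap)]; simp [hk]
    · push Not at hex
      rw [Finset.sum_eq_zero fun a ha => indicator_of_notMem (hex a ha) _, zero_add]
      exact hKk.trans le_add_self

variable [Fintype ζ] [DecidableEq ζ] [MeasurableSpace Ω] {μ : Measure Ω}
  {X : ℝ≥0 → Ω → ζ → ℤ}
  {lam : (ζ → ℤ) → ℝ≥0} {q : Transition ζ → (ζ → ℤ) → ℕ+ → ℝ≥0}

lemma measurableSet_onlyEvent (hX : IsMarkovCountingSystem μ X N) (t h : ℝ≥0)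
    (a : Transition ζ × ℕ+) : MeasurableSet (onlyEvent N t h a) :=
  hX.measurable_increment t h
    (Set.to_countable {ν : Transition ζ → ℕ |
      ν a.1 = a.2 ∧ ∀ p', p' ≠ a.1 → ν p' = 0}).measurableSet

/-- Partial sums of the series of moments are bounded by truncated moments of the increment. -/
lemma sum_pow_mul_measure_le (hX : IsMarkovCountingSystem μ X N) (P : Measure Ω) (t h : ℝ≥0)
    (k : ℕ) {K : ℕ} (T : Finset ℕ+) (hT : ∀ i ∈ T, (i : ℕ) ≤ K) :
    ∑ i ∈ T, ((i : ℕ) : ℝ≥0∞) ^ k * P (onlyEvent N t h (p, i))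
      ≤ ∫⁻ ω, ((min (increment N t h ω p) K : ℕ) : ℝ≥0∞) ^ k ∂P := by
  have hm := fun i => measurableSet_onlyEvent hX t h (p, i)
  calc _ = ∑ i ∈ T, ∫⁻ ω, (onlyEvent N t h (p, i)).indicator
        (fun _ => ((i : ℕ) : ℝ≥0∞) ^ k) ω ∂P :=
        Finset.sum_congr rfl fun i _ => by rw [lintegral_indicator_const (hm i)]
    _ = ∫⁻ ω, ∑ i ∈ T, (onlyEvent N t h (p, i)).indicator
        (fun _ => ((i : ℕ) : ℝ≥0∞) ^ k) ω ∂P := by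
        rw [lintegral_finsetSum]
        exact fun i _ => measurable_const.indicator (hm i)
    _ ≤ _ := by
        refine lintegral_mono fun ω => ?_
        classical
        have := sum_indicator_onlyEvent_le (N := N) (t := t) (h := h) (T.image (Prod.mk p))
          (fun a => ((a.2 : ℕ) : ℝ≥0∞) ^ k) ω
          (B := ((min (increment N t h ω p) K : ℕ) : ℝ≥0∞) ^ k) (fun a ha hω => by
            obtain ⟨i, hi, rfl⟩ := Finset.mem_image.1 ha
            have h1 : increment N t h ω p = i := hω.1
            rw [h1, min_eq_left (hT i hi)])
        rwa [Finset.sum_image (Prod.mk_right_injective p).injOn] at this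

/-- The truncated moments of the increment are asymptotically at most the moment of the
infinitesimal probabilities. -/
lemma eventually_truncated_moment_le [IsProbabilityMeasure μ] (hX : IsMarkovCountingSystem μ X N)
    (hq : HasInfinitesimalProbabilities μ X N q) (hlam : HasRateFunction μ X N lam)
    (hsc : IsStableConservative μ X q lam) {t : ℝ≥0} {x : ζ → ℤ} (hx : μ (X t ⁻¹' {x}) ≠ 0)
    (K : ℕ) {k : ℕ} (hk : k ≠ 0) (hsum : Summable fun i : ℕ+ => (i : ℝ) ^ k * (q p x i : ℝ))
    {ε : ℝ} (hε : 0 < ε) :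
    ∀ᶠ h : ℝ≥0 in 𝓝[>] 0,
      ∫⁻ ω, ((min (increment N t h ω p) K : ℕ) : ℝ≥0∞) ^ k ∂(μ[|X t ⁻¹' {x}])
        ≤ ENNReal.ofReal (h * (∑' i : ℕ+, (i : ℝ) ^ k * (q p x i : ℝ) + ε)) := by
  classical
  set P := μ[|X t ⁻¹' {x}] with hPdef
  have hP : IsProbabilityMeasure P := cond_isProbabilityMeasure hx
  set m := ∑' i : ℕ+, (i : ℝ) ^ k * (q p x i : ℝ) with hm
  have hKε : 0 < ε / ((K : ℝ) ^ k + 1) := by positivity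
  have hs : HasSum (fun a : Transition ζ × ℕ+ => (q a.1 x a.2 : ℝ)) (lam x) :=
    NNReal.hasSum_coe.2 (hsc t x hx)
  obtain ⟨S, hS⟩ := ((tendsto_order.1 hs).1 (lam x - ε / ((K : ℝ) ^ k + 1))
    (by linarith)).exists
  set w : Transition ζ × ℕ+ → ℝ := fun a => if a.1 = p then ((a.2 : ℕ) : ℝ) ^ k else 0 with hw
  have hlimE : ∀ a, Tendsto (fun h : ℝ≥0 => P.real (onlyEvent N t h a) / (h : ℝ)) (𝓝[>] 0)
      (𝓝 (q a.1 x a.2)) := fun a => hq t x hx a.1 a.2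
  have hlimD : Tendsto (fun h : ℝ≥0 => P.real {ω | increment N t h ω ≠ 0} / (h : ℝ)) (𝓝[>] 0)
      (𝓝 (lam x)) := by
    refine (hlam t x hx).congr fun h => ?_
    have e : {ω | increment N t h ω ≠ 0} = {ω | ∀ p, increment N t h ω p = 0}ᶜ := by
      ext ω; simp [funext_iff]
    rw [e, probReal_compl_eq_one_sub]
    exact hX.measurable_increment t h
      (Set.to_countable {ν : Transition ζ → ℕ | ∀ p, ν p = 0}).measurableSet
  have hlim : Tendsto (fun h : ℝ≥0 => ∑ a ∈ S, (w a - (K : ℝ) ^ k) *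
      (P.real (onlyEvent N t h a) / (h : ℝ))
      + (K : ℝ) ^ k * (P.real {ω | increment N t h ω ≠ 0} / (h : ℝ))) (𝓝[>] 0)
      (𝓝 (∑ a ∈ S, (w a - (K : ℝ) ^ k) * q a.1 x a.2 + (K : ℝ) ^ k * lam x)) :=
    (tendsto_finsetSum _ fun a _ => (hlimE a).const_mul _).add (hlimD.const_mul _)
  have hlt : ∑ a ∈ S, (w a - (K : ℝ) ^ k) * q a.1 x a.2 + (K : ℝ) ^ k * lam x < m + ε := by
    have h1 : ∑ a ∈ S, w a * q a.1 x a.2 ≤ m := by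
      have e : ∑ a ∈ S, w a * q a.1 x a.2
          = ∑ a ∈ S with a.1 = p, ((a.2 : ℕ) : ℝ) ^ k * q p x a.2 := by
        rw [Finset.sum_filter]
        refine Finset.sum_congr rfl fun a _ => ?_
        simp only [hw]
        split_ifs with h
        · rw [h]
        · simp
      rw [e, ← Finset.sum_image (g := fun a : Transition ζ × ℕ+ => a.2)
        (f := fun i : ℕ+ => (i : ℝ) ^ k * (q p x i : ℝ))]
      · exact hsum.sum_le_tsum _ fun i _ => by positivity
      · intro a ha b hb hab
        have ha' := (Finset.mem_filter.1 ha).2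
        have hb' := (Finset.mem_filter.1 hb).2
        exact Prod.ext (ha'.trans hb'.symm) hab
    have h2 : (K : ℝ) ^ k * (lam x - ∑ a ∈ S, (q a.1 x a.2 : ℝ)) < ε := by
      have h3 : lam x - ∑ a ∈ S, (q a.1 x a.2 : ℝ) < ε / ((K : ℝ) ^ k + 1) := by linarith
      have h4 : 0 ≤ (K : ℝ) ^ k := by positivity
      calc _ ≤ (K : ℝ) ^ k * (ε / ((K : ℝ) ^ k + 1)) := by gcongr
        _ < ((K : ℝ) ^ k + 1) * (ε / ((K : ℝ) ^ k + 1)) := by gcongr; linarith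
        _ = ε := by field_simp
    simp only [sub_mul, Finset.sum_sub_distrib, ← Finset.mul_sum]
    linarith
  filter_upwards [hlim.eventually (gt_mem_nhds hlt), self_mem_nhdsWithin] with h hh hpos
  have hpos' : (0 : ℝ) < h := hpos
  set I := ∫⁻ ω, ((min (increment N t h ω p) K : ℕ) : ℝ≥0∞) ^ k ∂P with hI
  have hItop : I ≠ ∞ := by
    refine ne_top_of_le_ne_top (b := (K : ℝ≥0∞) ^ k) (by finiteness) ?_
    calc I ≤ ∫⁻ _, (K : ℝ≥0∞) ^ k ∂P := lintegral_mono fun ω => by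
          gcongr; exact min_le_right _ _
      _ = _ := by simp
  have hmE := measurableSet_onlyEvent hX t h
  have hmD : MeasurableSet {ω | increment N t h ω ≠ 0} :=
    (hX.measurable_increment t h (measurableSet_singleton 0)).compl
  have hineq : ∑ a ∈ S, (K : ℝ≥0∞) ^ k * P (onlyEvent N t h a) + I
      ≤ ∑ a ∈ S, (if a.1 = p then ((a.2 : ℕ) : ℝ≥0∞) ^ k else 0) * P (onlyEvent N t h a)
        + (K : ℝ≥0∞) ^ k * P {ω | increment N t h ω ≠ 0} := by
    have h1 := lintegral_mono (μ := P)
      (truncated_moment_le (N := N) (p := p) (t := t) (h := h) K hk S)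
    rw [lintegral_add_left, lintegral_add_left, lintegral_finsetSum, lintegral_finsetSum] at h1
    · simpa only [lintegral_indicator_const (hmE _), lintegral_indicator_const hmD] using h1
    · exact fun a _ => measurable_const.indicator (hmE a)
    · exact fun a _ => measurable_const.indicator (hmE a)
    · exact Finset.measurable_fun_sum _ fun a _ => measurable_const.indicator (hmE a)
    · exact Finset.measurable_fun_sum _ fun a _ => measurable_const.indicator (hmE a)
  have hreal : ∑ a ∈ S, (K : ℝ) ^ k * P.real (onlyEvent N t h a) + I.toReal
      ≤ ∑ a ∈ S, w a * P.real (onlyEvent N t h a)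
        + (K : ℝ) ^ k * P.real {ω | increment N t h ω ≠ 0} := by
    have hw' : ∀ a, (if a.1 = p then ((a.2 : ℕ) : ℝ≥0∞) ^ k else 0) = ENNReal.ofReal (w a) := by
      intro a
      simp only [hw]
      split_ifs
      · rw [ENNReal.ofReal_pow (by positivity), ENNReal.ofReal_natCast]
      · simp
    have hw0 : ∀ a, 0 ≤ w a := fun a => by simp only [hw]; split_ifs <;> positivity
    have h2 := ENNReal.toReal_mono (by
      simp only [hw']
      refine ENNReal.add_ne_top.2 ⟨ENNReal.sum_ne_top.2 fun a _ => ?_, ?_⟩ <;> finiteness) hineq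
    rw [ENNReal.toReal_add (ENNReal.sum_ne_top.2 fun a _ => by finiteness) hItop,
      ENNReal.toReal_add (ENNReal.sum_ne_top.2 fun a _ => by rw [hw']; finiteness) (by finiteness),
      ENNReal.toReal_sum (fun a _ => by finiteness),
      ENNReal.toReal_sum (fun a _ => by rw [hw']; finiteness)] at h2
    simpa only [ENNReal.toReal_mul, ENNReal.toReal_pow, ENNReal.toReal_natCast, hw',
      ENNReal.toReal_ofReal (hw0 _), ← measureReal_def] using h2
  rw [← ENNReal.ofReal_toReal hItop]
  refine ENNReal.ofReal_le_ofReal ?_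
  have h3 : I.toReal / h ≤ m + ε := by
    refine le_trans ?_ hh.le
    have e : ∑ a ∈ S, (w a - (K : ℝ) ^ k) * (P.real (onlyEvent N t h a) / (h : ℝ))
        + (K : ℝ) ^ k * (P.real {ω | increment N t h ω ≠ 0} / (h : ℝ))
        = (∑ a ∈ S, w a * P.real (onlyEvent N t h a)
        + (K : ℝ) ^ k * P.real {ω | increment N t h ω ≠ 0}
        - ∑ a ∈ S, (K : ℝ) ^ k * P.real (onlyEvent N t h a)) / h := by
      simp only [sub_mul, Finset.sum_sub_distrib, ← mul_div_assoc, ← Finset.sum_div]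
      ring
    rw [e]
    gcongr
    linarith
  rw [mul_comm]
  exact (div_le_iff₀ hpos').1 h3

end InfinitesimalMoments

section RefiningGrids

lemma tendsto_div_add_one (h : ℝ≥0) :
    Tendsto (fun n : ℕ => h / ((n : ℝ≥0) + 1)) atTop (𝓝 0) := by
  rw [← NNReal.tendsto_coe]
  have := tendsto_const_div_atTop_nhds_zero_nat (h : ℝ)
  simpa using (tendsto_add_atTop_iff_nat 1).2 this

lemma tendsto_div_add_one_nhdsGT {h : ℝ≥0} (hh : 0 < h) :
    Tendsto (fun n : ℕ => h / ((n : ℝ≥0) + 1)) atTop (𝓝[>] 0) :=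
  tendsto_nhdsWithin_iff.2 ⟨tendsto_div_add_one h, Eventually.of_forall fun n =>
    div_pos hh (by positivity)⟩

lemma cast_succ_mul_div (h : ℝ≥0) (n : ℕ) : ((n + 1 : ℕ) : ℝ≥0) * (h / ((n : ℝ≥0) + 1)) = h := by
  push_cast; field_simp

/-- Over a horizon `hbar`, all grids on `[t, t + h]` leave enough time for a rate at least `a` to
produce an event with probability at least `c`, which does not depend on `h`. -/
lemma exists_grid {a hbar : ℝ≥0} (ha : 0 < a) (hbar0 : 0 < hbar) :
    ∃ c : ℝ≥0, 0 < c ∧ ∀ h : ℝ≥0, 0 < h → 4 * h ≤ hbar → ∃ R : ℕ, (R + 1) * h ≤ hbar ∧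
      ∀ K : ℕ, ∀ᶠ n : ℕ in atTop, max a K * (h / ((n : ℝ≥0) + 1)) ≤ 1 ∧
        (c : ℝ) ≤ 1 - (1 - a * (h / ((n : ℝ≥0) + 1) : ℝ≥0)) ^ ((n + 1) * R) := by
  have hahb : 0 < (a : ℝ) * hbar := by positivity
  have hexp : Real.exp (-(a * hbar / 2)) < 1 := by
    rw [← Real.exp_zero]; exact Real.exp_lt_exp.2 (by linarith)
  refine ⟨Real.toNNReal (1 - Real.exp (-(a * hbar / 2))), Real.toNNReal_pos.2 (by linarith),
    fun h hh h4 => ?_⟩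
  have hh' : (0 : ℝ) < h := hh
  have h4' : 4 * (h : ℝ) ≤ hbar := by exact_mod_cast h4
  have hf1 : (⌊(hbar : ℝ) / h⌋₊ : ℝ) * h ≤ hbar := by
    have := Nat.floor_le (div_nonneg hbar.coe_nonneg hh'.le)
    calc _ ≤ (hbar : ℝ) / h * h := by gcongr
      _ = hbar := by field_simp
  have hf2 : (hbar : ℝ) < (⌊(hbar : ℝ) / h⌋₊ + 1) * h := by
    have := Nat.lt_floor_add_one ((hbar : ℝ) / h)
    calc (hbar : ℝ) = (hbar : ℝ) / h * h := by field_simp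
      _ < _ := by gcongr
  obtain ⟨R, hR⟩ : ∃ R : ℕ, ⌊(hbar : ℝ) / h⌋₊ = R + 1 := by
    refine Nat.exists_eq_add_of_le' (Nat.le_floor ?_)
    rw [le_div_iff₀ hh']
    push_cast
    linarith
  rw [hR] at hf1 hf2
  push_cast at hf1 hf2
  refine ⟨R, by exact_mod_cast hf1, fun K => ?_⟩
  have hlim : Tendsto (fun n : ℕ => max a K * (h / ((n : ℝ≥0) + 1))) atTop (𝓝 0) := by
    simpa using (tendsto_div_add_one h).const_mul (max a K)
  filter_upwards [hlim.eventually (gt_mem_nhds one_pos)] with n hn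
  refine ⟨hn.le, ?_⟩
  rw [Real.coe_toNNReal _ (by linarith)]
  set d := h / ((n : ℝ≥0) + 1) with hd
  have e : ((n : ℝ) + 1) * d = h := by
    have := congrArg NNReal.toReal (cast_succ_mul_div h n)
    rw [← hd] at this
    exact_mod_cast this
  have had : (a : ℝ) * d ≤ 1 := by
    have : a * d ≤ 1 := le_trans (by gcongr; exact le_max_left _ _) hn.le
    exact_mod_cast this
  have h1 : (1 - (a : ℝ) * d) ^ ((n + 1) * R) ≤ Real.exp (-(a * hbar / 2)) := by
    calc (1 - (a : ℝ) * d) ^ ((n + 1) * R)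
        ≤ Real.exp (-(a * d)) ^ ((n + 1) * R) := by
          refine pow_le_pow_left₀ (by linarith) ?_ _
          exact Real.one_sub_le_exp_neg _
      _ = Real.exp (-(a * (R * h))) := by
          rw [← Real.exp_nat_mul, ← e]; push_cast; ring_nf
      _ ≤ _ := by
          refine Real.exp_le_exp.2 ?_
          have : (hbar : ℝ) / 2 ≤ R * h := by linarith
          have := mul_le_mul_of_nonneg_left this a.coe_nonneg
          linarith
  linarith

lemma le_add_mul_of_forall_gt {L b c B : ℝ≥0∞} (hc : c ≠ ∞) (hB : B ≠ ∞)
    (h : ∀ B' > B, L ≤ b + c * B') : L ≤ b + c * B := by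
  have : (𝓝[>] B).NeBot := nhdsGT_neBot_of_exists_gt ⟨⊤, hB.lt_top⟩
  have hcont : Tendsto (fun B' => b + c * B') (𝓝[>] B) (𝓝 (b + c * B)) :=
    ((ENNReal.Tendsto.const_mul tendsto_id (Or.inr hc)).const_add b).mono_left nhdsWithin_le_nhds
  exact ge_of_tendsto hcont (eventually_nhdsWithin_of_forall h)

lemma le_add_mul_of_limsup_le {L b c B : ℝ≥0∞} (hc : c ≠ ∞) (hB : B ≠ ∞) {A : ℕ → ℝ≥0∞}
    (hA : limsup A atTop ≤ B) (h : ∀ᶠ n in atTop, L ≤ b + c * A n) : L ≤ b + c * B := by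
  refine le_add_mul_of_forall_gt hc hB fun B' hB' => ?_
  obtain ⟨n, h1, h2⟩ := (h.and (eventually_lt_of_limsup_lt (hA.trans_lt hB'))).exists
  exact h1.trans (by gcongr)

lemma gridRate_mul_pow_le {ζ Ω : Type*} {X : ℝ≥0 → Ω → ζ → ℤ} {lam : (ζ → ℤ) → ℝ≥0}
    {a t δ : ℝ≥0} (ha : 0 < a) {K n : ℕ} (k : ℕ) (ω : Ω) (G : ℝ≥0∞) :
    (gridRate X lam a t δ K n ω : ℝ≥0∞) * G ^ (k + 1)
      ≤ (a : ℝ≥0∞)⁻¹ ^ k * (gridRate X lam a t δ K n ω * G) ^ (k + 1) := by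
  rcases gridRate_eq_zero_or_le (X := X) (lam := lam) (a := a) (t := t) (δ := δ) (K := K) (n := n)
    ω with h | h
  · rw [h]; simp
  · set g := gridRate X lam a t δ K n ω
    have h1 : (1 : ℝ≥0∞) ≤ (a : ℝ≥0∞)⁻¹ * g := by
      rw [← ENNReal.inv_mul_cancel (ENNReal.coe_ne_zero.2 ha.ne') ENNReal.coe_ne_top]
      gcongr
    calc (g : ℝ≥0∞) * G ^ (k + 1) = 1 ^ k * (g * G ^ (k + 1)) := by rw [one_pow, one_mul]
      _ ≤ ((a : ℝ≥0∞)⁻¹ * g) ^ k * (g * G ^ (k + 1)) := by gcongr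
      _ = _ := by ring

variable {ζ Ω : Type*} [Fintype ζ] [DecidableEq ζ] [MeasurableSpace Ω] {μ : Measure Ω}
  {X : ℝ≥0 → Ω → ζ → ℤ} {N : Transition ζ → ℝ≥0 → Ω → ℕ} {lam : (ζ → ℤ) → ℝ≥0}
  {q : Transition ζ → (ζ → ℤ) → ℕ+ → ℝ≥0} {p : Transition ζ}

/-- Moments of an increment are controlled by truncated moments of its approximations on grids. -/
lemma mul_lintegral_increment_pow_le (hX : IsMarkovCountingSystem μ X N) {P : Measure Ω}
    {t h : ℝ≥0} {k : ℕ} {C B : ℝ≥0∞}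
    (hB : ∀ K : ℕ, C * ∫⁻ ω, ⨅ n : ℕ,
      (gridIncrement X N lam p t (h / ((n : ℝ≥0) + 1)) K (n + 1) ω : ℝ≥0∞) ^ k ∂P ≤ B) :
    C * ∫⁻ ω, (increment N t h ω p : ℝ≥0∞) ^ k ∂P ≤ B := by
  set f : ℕ → Ω → ℝ≥0∞ := fun K ω => ⨅ n : ℕ,
      (gridIncrement X N lam p t (h / ((n : ℝ≥0) + 1)) K (n + 1) ω : ℝ≥0∞) ^ k
  have hf : ∀ K, Measurable (f K) := fun K => Measurable.iInf fun n =>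
    (measurable_of_countable (fun i : ℕ => (i : ℝ≥0∞) ^ k)).comp
      (hX.measurable_gridIncrement t _ K (n + 1))
  have hmono : Monotone f := by
    intro K K' hK ω
    refine iInf_mono fun n => ?_
    refine pow_le_pow_left₀ zero_le (Nat.cast_le.2 (Finset.sum_le_sum fun j _ => ?_)) k
    have hK' : (K : ℝ≥0) ≤ K' := by exact_mod_cast hK
    unfold cellIncrement
    split_ifs with h1 h2
    · exact min_le_min le_rfl hK
    · exact absurd (h1.trans hK') h2
    · exact Nat.zero_le _
    · exact le_rfl
  calc _ ≤ C * ∫⁻ ω, ⨆ K, f K ω ∂P := by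
        gcongr with ω
        obtain ⟨K₁, hK₁⟩ := exists_rate_le (lam := lam) hX t h ω
        refine le_iSup_of_le (max K₁ (increment N t h ω p)) (le_iInf fun n => ?_)
        refine pow_le_pow_left₀ zero_le (Nat.cast_le.2 ?_) k
        have h1 := hX.le_gridIncrement (p := p) (lam := lam) (t := t) (δ := h / ((n : ℝ≥0) + 1))
          (K := max K₁ (increment N t h ω p)) (n := n + 1) (ω := ω)
        rw [cast_succ_mul_div] at h1
        refine h1 (le_max_right _ _) fun s hs => (hK₁ s hs).trans ?_
        exact_mod_cast le_max_left _ _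
    _ = ⨆ K, C * ∫⁻ ω, f K ω ∂P := by rw [lintegral_iSup hf hmono, ENNReal.mul_iSup]
    _ ≤ B := iSup_le hB

variable [IsProbabilityMeasure μ]

/-- Finiteness of the moments of the infinitesimal probabilities. -/
lemma summable_pow_mul (hX : IsMarkovCountingSystem μ X N)
    (hhom : IsTimeHomogeneous μ X N) (hq : HasInfinitesimalProbabilities μ X N q)
    (hlam : HasRateFunction μ X N lam) {t hbar : ℝ≥0} (hbar0 : 0 < hbar) {x : ζ → ℤ}
    (hx : μ (X t ⁻¹' {x}) ≠ 0) (ha : 0 < lam x) (k : ℕ)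
    (hY : ∫⁻ ω, (jumpBound (N p) t hbar ω * rateBound X lam t hbar ω) ^ (k + 1)
      ∂(μ[|X t ⁻¹' {x}]) ≠ ∞) :
    Summable fun i : ℕ+ => (i : ℝ) ^ (k + 1) * (q p x i : ℝ) := by
  set P := μ[|X t ⁻¹' {x}] with hPdef
  have hP : IsProbabilityMeasure P := cond_isProbabilityMeasure hx
  set Y := fun ω => jumpBound (N p) t hbar ω * rateBound X lam t hbar ω with hYdef
  obtain ⟨c, hc0, hgrid⟩ := exists_grid ha hbar0
  have hh : 0 < hbar / 4 := by positivity
  obtain ⟨R, hR, hev⟩ := hgrid (hbar / 4) hh (by rw [mul_div_cancel₀ _ four_ne_zero])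
  set h := hbar / 4
  set B : ℝ≥0∞ := (c : ℝ≥0∞)⁻¹ * ((lam x : ℝ≥0∞)⁻¹ ^ k * (∫⁻ ω, Y ω ^ (k + 1) ∂P + 1)) with hB
  have hc' : (c : ℝ≥0∞) ≠ 0 := ENNReal.coe_ne_zero.2 hc0.ne'
  have ha' : (lam x : ℝ≥0∞) ≠ 0 := ENNReal.coe_ne_zero.2 ha.ne'
  have hBtop : B ≠ ∞ := by
    have h1 := ENNReal.inv_ne_top.2 hc'
    have h2 := ENNReal.inv_ne_top.2 ha'
    finiteness
  refine summable_of_sum_le (c := B.toReal) (fun i => by positivity) fun T => ?_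
  obtain ⟨K, hKT, hKx⟩ : ∃ K : ℕ, (∀ i ∈ T, (i : ℕ) ≤ K) ∧ lam x ≤ K := by
    obtain ⟨K, hK⟩ := exists_nat_ge (lam x)
    refine ⟨max K (T.sup fun i : ℕ+ => (i : ℕ)), fun i hi => le_max_of_le_right
      (Finset.le_sup (f := fun i : ℕ+ => (i : ℕ)) hi), hK.trans (by exact_mod_cast le_max_left _ _)⟩
  set δ : ℕ → ℝ≥0 := fun n => h / ((n : ℝ≥0) + 1) with hδ
  have hcells : ∀ i, ((i + 1 + (i + 1) * R : ℕ) : ℝ≥0) * δ i ≤ hbar := fun i => by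
    refine le_trans (le_of_eq ?_) hR
    calc _ = ((R : ℝ≥0) + 1) * (((i + 1 : ℕ) : ℝ≥0) * δ i) := by push_cast; ring
      _ = _ := by rw [cast_succ_mul_div]
  have hsup := limsup_setLIntegral_grid_le (p := p) (lam := lam) hX hx
    (tendsto_div_add_one h) (K := K) (n := fun i => i + 1) (m := fun i => i + 1 + (i + 1) * R)
    (hbar := hbar)
    (fun i => le_trans (mul_le_mul_left (Nat.cast_le.2 (Nat.le_add_right _ _)) _) (hcells i)) hcells
    (k + 1) univ
  simp only [Measure.restrict_univ] at hsup
  have hlt := eventually_lt_of_limsup_lt (hsup.trans_lt (ENNReal.lt_add_right hY one_ne_zero))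
  have hlim : Tendsto (fun n => ∑ i ∈ T, (i : ℝ) ^ (k + 1)
      * (P.real (onlyEvent N t (δ n) (p, i)) / (δ n : ℝ))) atTop
      (𝓝 (∑ i ∈ T, (i : ℝ) ^ (k + 1) * (q p x i : ℝ))) :=
    tendsto_finsetSum _ fun i _ =>
      ((hq t x hx p i).comp (tendsto_div_add_one_nhdsGT hh)).const_mul _
  refine le_of_tendsto hlim ?_
  filter_upwards [hlt, hev K] with n hn ⟨hn1, hn2⟩
  have hδ0 : 0 < δ n := div_pos hh (by positivity)
  have h1 := sum_pow_mul_measure_le (p := p) hX P t (δ n) (k + 1) T hKT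
  have hone : Measurable[history X N (t + ((0 : ℕ) : ℝ≥0) * δ n)] fun _ : Ω => (1 : ℝ≥0∞) :=
    @measurable_const _ _ _ (_) _
  have h2 := lintegral_cellIncrement_mul_le hX hhom hlam (p := p) (x := x) (n := n + 1)
    (j := 0) (K := K) k.succ_ne_zero n.succ_pos hn1 hn2 hone
  have h3 : ∫⁻ ω, ((min (increment N t (δ n) ω p) K : ℕ) : ℝ≥0∞) ^ (k + 1) ∂P
      = ∫⁻ ω, (cellIncrement X N lam p t (δ n) K 0 ω : ℝ≥0∞) ^ (k + 1) * 1 ∂P := by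
    have hXt : MeasurableSet (X t ⁻¹' {x}) := hX.measurable_state t (measurableSet_singleton x)
    refine lintegral_congr_ae ?_
    filter_upwards [ae_cond_mem hXt] with ω hω
    have hω' : X t ω = x := hω
    simp [cellIncrement, hω', hKx]
  rw [← h3] at h2
  have h4 : ∫⁻ ω, gridRate X lam (lam x) t (δ n) K (n + 1) ω
      * (gridJump N p t (δ n) K (n + 1 + (n + 1) * R) ω : ℝ≥0∞) ^ (k + 1) * 1 ∂P
      ≤ (lam x : ℝ≥0∞)⁻¹ ^ k * (∫⁻ ω, Y ω ^ (k + 1) ∂P + 1) := by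
    refine le_trans ?_ (mul_le_mul' le_rfl hn.le)
    rw [← lintegral_const_mul' _ _ (by finiteness [ENNReal.inv_ne_top.2 ha'])]
    refine lintegral_mono fun ω => ?_
    rw [mul_one]
    exact gridRate_mul_pow_le ha k ω _
  have h5 : ∑ i ∈ T, ((i : ℕ) : ℝ≥0∞) ^ (k + 1) * P (onlyEvent N t (δ n) (p, i)) ≤ δ n * B := by
    rw [hB, mul_left_comm, ← ENNReal.mul_le_iff_le_inv hc' ENNReal.coe_ne_top]
    exact (mul_le_mul' le_rfl h1).trans (h2.trans (mul_le_mul' le_rfl h4))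
  have h6 := ENNReal.toReal_mono (by finiteness) h5
  rw [ENNReal.toReal_sum (fun i _ => by finiteness)] at h6
  simp only [ENNReal.toReal_mul, ENNReal.toReal_pow, ENNReal.toReal_natCast, ENNReal.coe_toReal,
    ← measureReal_def] at h6
  simp only [← mul_div_assoc, ← Finset.sum_div]
  rw [div_le_iff₀ (by exact_mod_cast hδ0), mul_comm B.toReal]
  exact h6

end RefiningGrids

section MomentBounds

lemma two_mul_mul_le {b : ℝ≥0} (hb : 0 < b) (g w : ℝ≥0) :
    2 * ((g : ℝ≥0∞) * w) ≤ b * (w : ℝ≥0∞) ^ 2 + (b : ℝ≥0∞)⁻¹ * (g : ℝ≥0∞) ^ 2 := by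
  have h : 2 * (g * w) ≤ b * w ^ 2 + b⁻¹ * g ^ 2 := by
    rw [← NNReal.coe_le_coe]
    push_cast
    have hbr : (0 : ℝ) < b := hb
    have : (b : ℝ) * w ^ 2 + (b : ℝ)⁻¹ * g ^ 2 - 2 * (g * w) = (b : ℝ)⁻¹ * (b * w - g) ^ 2 := by
      field_simp; ring
    have h0 : 0 ≤ (b : ℝ)⁻¹ * (b * w - g) ^ 2 := by positivity
    linarith
  rw [← ENNReal.coe_inv hb.ne']
  exact_mod_cast ENNReal.coe_le_coe.2 h

variable {ζ Ω : Type*} [Fintype ζ] [DecidableEq ζ] [MeasurableSpace Ω] {μ : Measure Ω}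
  [IsProbabilityMeasure μ]
  {X : ℝ≥0 → Ω → ζ → ℤ} {N : Transition ζ → ℝ≥0 → Ω → ℕ} {lam : (ζ → ℤ) → ℝ≥0}
  {q : Transition ζ → (ζ → ℤ) → ℕ+ → ℝ≥0} {p : Transition ζ}

lemma eventually_sum_lintegral_cellIncrement_le (hX : IsMarkovCountingSystem μ X N)
    (hhom : IsTimeHomogeneous μ X N) (hq : HasInfinitesimalProbabilities μ X N q)
    (hlam : HasRateFunction μ X N lam) (hsc : IsStableConservative μ X q lam) {t : ℝ≥0}
    {x : ζ → ℤ} (hx : μ (X t ⁻¹' {x}) ≠ 0) (ha : 0 < lam x) {c h : ℝ≥0} (hh : 0 < h) {R K k : ℕ}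
    (hev : ∀ᶠ n : ℕ in atTop, max (lam x) K * (h / ((n : ℝ≥0) + 1)) ≤ 1 ∧
      (c : ℝ) ≤ 1 - (1 - lam x * (h / ((n : ℝ≥0) + 1) : ℝ≥0)) ^ ((n + 1) * R))
    (hsum : Summable fun i : ℕ+ => (i : ℝ) ^ (k + 1) * (q p x i : ℝ)) {ε : ℝ} (hε : 0 < ε) :
    ∀ᶠ n : ℕ in atTop,
      c * ∑ j ∈ Finset.range (n + 1), ∫⁻ ω, (cellIncrement X N lam p t (h / ((n : ℝ≥0) + 1)) K j ω :
          ℝ≥0∞) ^ (k + 1) ∂(μ[|X t ⁻¹' {x}])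
        ≤ c * ENNReal.ofReal (h * (∑' i : ℕ+, (i : ℝ) ^ (k + 1) * (q p x i : ℝ) + ε))
          + h * (lam x : ℝ≥0∞)⁻¹ ^ k * ∫⁻ ω in {ω | increment N t h ω ≠ 0},
            (gridRate X lam (lam x) t (h / ((n : ℝ≥0) + 1)) K (n + 1) ω
              * (gridJump N p t (h / ((n : ℝ≥0) + 1)) K (n + 1 + (n + 1) * R) ω : ℝ≥0∞)) ^ (k + 1)
              ∂(μ[|X t ⁻¹' {x}]) := by
  have htr := (tendsto_div_add_one_nhdsGT hh).eventually
    (eventually_truncated_moment_le (p := p) hX hq hlam hsc hx K k.succ_ne_zero hsum hε)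
  filter_upwards [hev, htr] with n ⟨hn1, hn2⟩ hn3
  have h1 := sum_lintegral_cellIncrement_le hX hhom hlam (p := p) hx (n := n + 1) (K := K)
    k.succ_ne_zero hn1 hn2
  have e1 : ((n + 1 : ℕ) : ℝ≥0∞) * ((h / ((n : ℝ≥0) + 1) : ℝ≥0) : ℝ≥0∞) = h := by
    exact_mod_cast congrArg ((↑) : ℝ≥0 → ℝ≥0∞) (cast_succ_mul_div h n)
  rw [cast_succ_mul_div, e1] at h1
  refine h1.trans (add_le_add (mul_le_mul' le_rfl ?_) ?_)
  · refine (mul_le_mul' le_rfl hn3).trans (le_of_eq ?_)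
    rw [← ENNReal.ofReal_natCast, ← ENNReal.ofReal_mul (by positivity), ← mul_assoc]
    congr 2
    exact_mod_cast congrArg NNReal.toReal (cast_succ_mul_div h n)
  · rw [mul_assoc]
    refine mul_le_mul' le_rfl ?_
    rw [← lintegral_const_mul' _ _ (ENNReal.pow_ne_top (ENNReal.inv_ne_top.2
      (ENNReal.coe_ne_zero.2 ha.ne')))]
    exact lintegral_mono fun ω => gridRate_mul_pow_le ha k ω _

lemma limsup_grid_le (hX : IsMarkovCountingSystem μ X N) {t hbar h : ℝ≥0}
    {x : ζ → ℤ} (hx : μ (X t ⁻¹' {x}) ≠ 0) {R : ℕ} (hR : (R + 1) * h ≤ hbar) (K k : ℕ) (D : Set Ω) :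
    limsup (fun n : ℕ => ∫⁻ ω in D, (gridRate X lam (lam x) t (h / ((n : ℝ≥0) + 1)) K (n + 1) ω
        * (gridJump N p t (h / ((n : ℝ≥0) + 1)) K (n + 1 + (n + 1) * R) ω : ℝ≥0∞)) ^ k
          ∂(μ[|X t ⁻¹' {x}])) atTop
      ≤ ∫⁻ ω in D, (jumpBound (N p) t hbar ω * rateBound X lam t hbar ω) ^ k
        ∂(μ[|X t ⁻¹' {x}]) := by
  have hcells : ∀ i : ℕ, ((i + 1 + (i + 1) * R : ℕ) : ℝ≥0) * (h / ((i : ℝ≥0) + 1)) ≤ hbar :=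
    fun i => by
      refine le_trans (le_of_eq ?_) hR
      calc _ = ((R : ℝ≥0) + 1) * (((i + 1 : ℕ) : ℝ≥0) * (h / ((i : ℝ≥0) + 1))) := by push_cast; ring
        _ = _ := by rw [cast_succ_mul_div]
  exact limsup_setLIntegral_grid_le hX hx (tendsto_div_add_one h) (n := fun i => i + 1)
    (m := fun i => i + 1 + (i + 1) * R)
    (fun i => le_trans (mul_le_mul_left (Nat.cast_le.2 (Nat.le_add_right _ _)) _) (hcells i)) hcells
    k D

/-- Upper bound for the mean of an increment. -/
lemma lintegral_increment_le (hX : IsMarkovCountingSystem μ X N)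
    (hhom : IsTimeHomogeneous μ X N) (hq : HasInfinitesimalProbabilities μ X N q)
    (hlam : HasRateFunction μ X N lam) (hsc : IsStableConservative μ X q lam) {t hbar : ℝ≥0}
    {x : ζ → ℤ} (hx : μ (X t ⁻¹' {x}) ≠ 0) (ha : 0 < lam x) {c h : ℝ≥0} (hh : 0 < h) {R : ℕ}
    (hR : (R + 1) * h ≤ hbar)
    (hev : ∀ K : ℕ, ∀ᶠ n : ℕ in atTop, max (lam x) K * (h / ((n : ℝ≥0) + 1)) ≤ 1 ∧
      (c : ℝ) ≤ 1 - (1 - lam x * (h / ((n : ℝ≥0) + 1) : ℝ≥0)) ^ ((n + 1) * R))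
    (hsum : Summable fun i : ℕ+ => (i : ℝ) * (q p x i : ℝ)) {ε : ℝ} (hε : 0 < ε)
    (hY : ∫⁻ ω, jumpBound (N p) t hbar ω * rateBound X lam t hbar ω ∂(μ[|X t ⁻¹' {x}]) ≠ ∞) :
    c * ∫⁻ ω, (increment N t h ω p : ℝ≥0∞) ∂(μ[|X t ⁻¹' {x}])
      ≤ c * ENNReal.ofReal (h * (∑' i : ℕ+, (i : ℝ) * (q p x i : ℝ) + ε))
        + h * ∫⁻ ω in {ω | increment N t h ω ≠ 0},
          jumpBound (N p) t hbar ω * rateBound X lam t hbar ω ∂(μ[|X t ⁻¹' {x}]) := by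
  have hmain := mul_lintegral_increment_pow_le hX (lam := lam) (p := p) (P := μ[|X t ⁻¹' {x}])
    (t := t) (h := h) (k := 1) (C := c)
    (B := c * ENNReal.ofReal (h * (∑' i : ℕ+, (i : ℝ) * (q p x i : ℝ) + ε))
        + h * ∫⁻ ω in {ω | increment N t h ω ≠ 0},
          jumpBound (N p) t hbar ω * rateBound X lam t hbar ω ∂(μ[|X t ⁻¹' {x}])) fun K => by
    have hls := limsup_grid_le (lam := lam) (p := p) hX hx hR K 1 {ω | increment N t h ω ≠ 0}
    simp only [pow_one] at hls
    refine le_add_mul_of_limsup_le ENNReal.coe_ne_top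
      (ne_top_of_le_ne_top hY (setLIntegral_le_lintegral _ _)) hls ?_
    have hd := eventually_sum_lintegral_cellIncrement_le hX hhom hq hlam hsc hx ha hh (hev K)
      (p := p) (k := 0) (by simpa using hsum) hε
    simp only [zero_add, pow_one, pow_zero, mul_one] at hd
    filter_upwards [hd] with n hn
    refine le_trans (mul_le_mul' le_rfl ?_) hn
    have hm : ∀ j, Measurable fun ω =>
        (cellIncrement X N lam p t (h / ((n : ℝ≥0) + 1)) K j ω : ℝ≥0∞) := fun j =>
      (measurable_of_countable (fun n : ℕ => (n : ℝ≥0∞))).comp (hX.measurable_cellIncrement _ _ _ _)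
    rw [← lintegral_finsetSum _ fun j _ => hm j]
    refine lintegral_mono fun ω => (iInf_le _ n).trans (le_of_eq ?_)
    simp [gridIncrement]
  simpa using hmain

/-- Upper bound for the second moment of an increment. -/
lemma lintegral_increment_sq_le (hX : IsMarkovCountingSystem μ X N)
    (hhom : IsTimeHomogeneous μ X N) (hq : HasInfinitesimalProbabilities μ X N q)
    (hlam : HasRateFunction μ X N lam) (hsc : IsStableConservative μ X q lam) {t hbar : ℝ≥0}
    {x : ζ → ℤ} (hx : μ (X t ⁻¹' {x}) ≠ 0) (ha : 0 < lam x) {c h : ℝ≥0} (hh : 0 < h) {R : ℕ}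
    (hR : (R + 1) * h ≤ hbar)
    (hev : ∀ K : ℕ, ∀ᶠ n : ℕ in atTop, max (lam x) K * (h / ((n : ℝ≥0) + 1)) ≤ 1 ∧
      (c : ℝ) ≤ 1 - (1 - lam x * (h / ((n : ℝ≥0) + 1) : ℝ≥0)) ^ ((n + 1) * R))
    (hsum : Summable fun i : ℕ+ => (i : ℝ) ^ 2 * (q p x i : ℝ)) {ε : ℝ} (hε : 0 < ε)
    (hY : ∫⁻ ω, (jumpBound (N p) t hbar ω * rateBound X lam t hbar ω) ^ 2
      ∂(μ[|X t ⁻¹' {x}]) ≠ ∞) {b : ℝ≥0} (hb : 0 < b) :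
    (c - h * b : ℝ≥0) * ∫⁻ ω, (increment N t h ω p : ℝ≥0∞) ^ 2 ∂(μ[|X t ⁻¹' {x}])
      ≤ c * ENNReal.ofReal (h * (∑' i : ℕ+, (i : ℝ) ^ 2 * (q p x i : ℝ) + ε))
        + h * (lam x : ℝ≥0∞)⁻¹ * ∫⁻ ω in {ω | increment N t h ω ≠ 0},
          (jumpBound (N p) t hbar ω * rateBound X lam t hbar ω) ^ 2 ∂(μ[|X t ⁻¹' {x}])
        + h * (b : ℝ≥0∞)⁻¹ * ∫⁻ ω, (jumpBound (N p) t hbar ω * rateBound X lam t hbar ω) ^ 2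
          ∂(μ[|X t ⁻¹' {x}]) := by
  have hP : IsProbabilityMeasure (μ[|X t ⁻¹' {x}]) := cond_isProbabilityMeasure hx
  have ha' : (lam x : ℝ≥0∞)⁻¹ ≠ ∞ := ENNReal.inv_ne_top.2 (ENNReal.coe_ne_zero.2 ha.ne')
  have hb0 : (b : ℝ≥0∞) ≠ 0 := ENNReal.coe_ne_zero.2 hb.ne'
  have hb' : (b : ℝ≥0∞)⁻¹ ≠ ∞ := ENNReal.inv_ne_top.2 hb0
  refine mul_lintegral_increment_pow_le hX (lam := lam) fun K => ?_
  have hls := limsup_grid_le (lam := lam) (p := p) hX hx hR K 2 {ω | increment N t h ω ≠ 0}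
  have hls' := limsup_grid_le (lam := lam) (p := p) hX hx hR K 2 univ
  simp only [Measure.restrict_univ] at hls'
  refine le_add_mul_of_forall_gt (by finiteness) hY fun B' hB' => ?_
  rw [add_right_comm]
  refine le_add_mul_of_limsup_le (by finiteness)
    (ne_top_of_le_ne_top hY (setLIntegral_le_lintegral _ _)) hls ?_
  have hd := eventually_sum_lintegral_cellIncrement_le hX hhom hq hlam hsc hx ha hh (hev K)
    (p := p) (k := 1) hsum hε
  simp only [one_add_one_eq_two, pow_one] at hd
  filter_upwards [hd, hev K, eventually_lt_of_limsup_lt (hls'.trans_lt hB')] with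
    n hn ⟨hn1, hn2⟩ hn3
  set P := μ[|X t ⁻¹' {x}]
  set δ := h / ((n : ℝ≥0) + 1) with hδ
  set W : Ω → ℝ≥0∞ := fun ω => (gridIncrement X N lam p t δ K (n + 1) ω : ℝ≥0∞) with hW
  set H : Ω → ℝ≥0∞ := fun ω => gridRate X lam (lam x) t δ K (n + 1) ω
    * (gridJump N p t δ K (n + 1 + (n + 1) * R) ω : ℝ≥0∞) with hH
  have hWm : Measurable W := (measurable_of_countable (fun n : ℕ => (n : ℝ≥0∞))).comp
    (hX.measurable_gridIncrement _ _ _ _)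
  have hWtop : ∫⁻ ω, W ω ^ 2 ∂P ≠ ∞ := by
    refine ne_top_of_le_ne_top (b := (((n + 1) * K : ℕ) : ℝ≥0∞) ^ 2) (by finiteness) ?_
    calc _ ≤ ∫⁻ _, (((n + 1) * K : ℕ) : ℝ≥0∞) ^ 2 ∂P := by
          refine lintegral_mono fun ω => ?_
          refine pow_le_pow_left₀ zero_le (Nat.cast_le.2 ?_) 2
          refine (Finset.sum_le_card_nsmul _ _ K fun j _ => ?_).trans (by simp)
          unfold cellIncrement
          split_ifs
          · exact min_le_right _ _
          · exact Nat.zero_le _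
      _ = _ := by simp
  have h1 := lintegral_gridIncrement_sq_le hX hhom hlam (p := p) (t := t) (x := x) (n := n + 1)
    (K := K) hn1 hn2
  have e1 : ((n + 1 : ℕ) : ℝ≥0∞) * (δ : ℝ≥0∞) = h := by
    have := congrArg ((↑) : ℝ≥0 → ℝ≥0∞) (cast_succ_mul_div h n)
    rw [← hδ] at this
    exact_mod_cast this
  rw [e1] at h1
  have hyoung : 2 * ∫⁻ ω, H ω * W ω ∂P
      ≤ b * ∫⁻ ω, W ω ^ 2 ∂P + (b : ℝ≥0∞)⁻¹ * ∫⁻ ω, H ω ^ 2 ∂P := by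
    rw [← lintegral_const_mul' _ _ ENNReal.ofNat_ne_top, ← lintegral_const_mul' _ _
      ENNReal.coe_ne_top, ← lintegral_const_mul' _ _ hb', ← lintegral_add_left
      ((hWm.pow_const 2).const_mul _)]
    refine lintegral_mono fun ω => ?_
    simpa [hW, hH] using two_mul_mul_le hb (gridRate X lam (lam x) t δ K (n + 1) ω
      * (gridJump N p t δ K (n + 1 + (n + 1) * R) ω : ℝ≥0))
      (gridIncrement X N lam p t δ K (n + 1) ω : ℝ≥0)
  have hle : (c : ℝ≥0∞) * ∫⁻ ω, W ω ^ 2 ∂P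
      ≤ (c * ENNReal.ofReal (h * (∑' i : ℕ+, (i : ℝ) ^ 2 * (q p x i : ℝ) + ε))
        + h * (b : ℝ≥0∞)⁻¹ * B'
        + h * (lam x : ℝ≥0∞)⁻¹ * ∫⁻ ω in {ω | increment N t h ω ≠ 0}, H ω ^ 2 ∂P)
        + ((h * b : ℝ≥0) : ℝ≥0∞) * ∫⁻ ω, W ω ^ 2 ∂P := by
    calc _ ≤ _ := h1
      _ ≤ (c * ENNReal.ofReal (h * (∑' i : ℕ+, (i : ℝ) ^ 2 * (q p x i : ℝ) + ε))
          + h * (lam x : ℝ≥0∞)⁻¹ * ∫⁻ ω in {ω | increment N t h ω ≠ 0}, H ω ^ 2 ∂P)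
          + h * (b * ∫⁻ ω, W ω ^ 2 ∂P + (b : ℝ≥0∞)⁻¹ * B') := by
        refine add_le_add hn ?_
        calc 2 * (h : ℝ≥0∞) * ∫⁻ ω, H ω * W ω ∂P = h * (2 * ∫⁻ ω, H ω * W ω ∂P) := by ring
          _ ≤ _ := mul_le_mul' le_rfl (hyoung.trans
            (add_le_add le_rfl (mul_le_mul' le_rfl hn3.le)))
      _ = _ := by push_cast; ring
  calc _ ≤ ((c - h * b : ℝ≥0) : ℝ≥0∞) * ∫⁻ ω, W ω ^ 2 ∂P := by
        refine mul_le_mul' le_rfl (lintegral_mono fun ω => iInf_le _ n)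
    _ = c * ∫⁻ ω, W ω ^ 2 ∂P - ((h * b : ℝ≥0) : ℝ≥0∞) * ∫⁻ ω, W ω ^ 2 ∂P := by
        rw [ENNReal.coe_sub, ENNReal.sub_mul fun _ _ => hWtop]
    _ ≤ _ := tsub_le_iff_right.2 hle

end MomentBounds

section Limits

lemma lintegral_enorm_sq_ne_top_of_evariance {Ω : Type*} [MeasurableSpace Ω] {P : Measure Ω}
    [IsFiniteMeasure P] {f : Ω → ℝ}
    (h : evariance f P < ∞) : ∫⁻ ω, ‖f ω‖ₑ ^ 2 ∂P ≠ ∞ := by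
  set e := ∫ ω, f ω ∂P with he
  have hle : ∀ ω, ‖f ω‖ₑ ^ 2 ≤ 2 * ‖f ω - e‖ₑ ^ 2 + 2 * ‖e‖ₑ ^ 2 := by
    intro ω
    simp only [Real.enorm_eq_ofReal_abs, ← ENNReal.ofReal_pow (abs_nonneg _), sq_abs]
    rw [← ENNReal.ofReal_ofNat 2, ← ENNReal.ofReal_mul (by norm_num),
      ← ENNReal.ofReal_mul (by norm_num), ← ENNReal.ofReal_add (by positivity) (by positivity)]
    refine ENNReal.ofReal_le_ofReal ?_
    nlinarith [sq_nonneg (f ω - 2 * e)]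
  refine ne_top_of_le_ne_top ?_ (lintegral_mono hle)
  rw [lintegral_add_right _ measurable_const, lintegral_const_mul' _ _ ENNReal.ofNat_ne_top,
    lintegral_const]
  have h1 : ∫⁻ ω, ‖f ω - e‖ₑ ^ 2 ∂P ≠ ∞ := h.ne
  finiteness

lemma q_eq_zero_of_rate_eq_zero {ζ Ω : Type*} [MeasurableSpace Ω] {μ : Measure Ω}
    {X : ℝ≥0 → Ω → ζ → ℤ} {lam : (ζ → ℤ) → ℝ≥0} {q : Transition ζ → (ζ → ℤ) → ℕ+ → ℝ≥0}
    {p : Transition ζ} (hsc : IsStableConservative μ X q lam) {t : ℝ≥0} {x : ζ → ℤ}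
    (hx : μ (X t ⁻¹' {x}) ≠ 0) (h0 : lam x = 0) (i : ℕ+) : q p x i = 0 := by
  have h1 := hsc t x hx
  rw [h0] at h1
  exact congrFun ((hasSum_zero_iff_of_nonneg fun _ => zero_le).1 h1) (p, i)

variable {ζ Ω : Type*} [Fintype ζ] [DecidableEq ζ] [MeasurableSpace Ω] {μ : Measure Ω}
  {X : ℝ≥0 → Ω → ζ → ℤ} {N : Transition ζ → ℝ≥0 → Ω → ℕ} {lam : (ζ → ℤ) → ℝ≥0}
  {q : Transition ζ → (ζ → ℤ) → ℕ+ → ℝ≥0} {p : Transition ζ}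

lemma measurable_increment_real (hX : IsMarkovCountingSystem μ X N) (t h : ℝ≥0) :
    Measurable fun ω => (increment N t h ω p : ℝ) :=
  (measurable_of_countable (fun ν : Transition ζ → ℕ => (ν p : ℝ))).comp
    (hX.measurable_increment t h)

lemma integral_increment_pow (hX : IsMarkovCountingSystem μ X N) (P : Measure Ω) (t h : ℝ≥0)
    (k : ℕ) : ∫ ω, (increment N t h ω p : ℝ) ^ k ∂P
      = (∫⁻ ω, (increment N t h ω p : ℝ≥0∞) ^ k ∂P).toReal := by
  rw [integral_eq_lintegral_of_nonneg_ae (ae_of_all _ fun ω => by positivity)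
    ((measurable_increment_real hX t h).pow_const k).aestronglyMeasurable]
  congr 1
  refine lintegral_congr fun ω => ?_
  rw [ENNReal.ofReal_pow (by positivity), ENNReal.ofReal_natCast]

lemma integrable_increment_pow (hX : IsMarkovCountingSystem μ X N) {P : Measure Ω} {t h : ℝ≥0}
    {k : ℕ} (hfin : ∫⁻ ω, (increment N t h ω p : ℝ≥0∞) ^ k ∂P ≠ ∞) :
    Integrable (fun ω => (increment N t h ω p : ℝ) ^ k) P := by
  refine ⟨((measurable_increment_real hX t h).pow_const k).aestronglyMeasurable, ?_⟩
  rw [hasFiniteIntegral_iff_ofReal (ae_of_all _ fun ω => by positivity)]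
  refine lt_of_eq_of_lt (lintegral_congr fun ω => ?_) hfin.lt_top
  rw [ENNReal.ofReal_pow (by positivity), ENNReal.ofReal_natCast]

lemma jumpBound_mul_rateBound_ne_top (hX : IsMarkovCountingSystem μ X N) (t hbar : ℝ≥0) (ω : Ω) :
    jumpBound (N p) t hbar ω * rateBound X lam t hbar ω ≠ ∞ := by
  refine ENNReal.mul_ne_top ?_ ?_
  · refine ne_top_of_le_ne_top (ENNReal.natCast_ne_top (N p (t + hbar) ω)) (iSup₂_le fun s hs => ?_)
    exact_mod_cast (Nat.sub_le _ _).trans ((hX.counting p).mono ω hs.2)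
  · obtain ⟨K, hK⟩ := exists_rate_le (lam := lam) hX t hbar ω
    refine ne_top_of_le_ne_top (ENNReal.natCast_ne_top K) (iSup₂_le fun s hs => ?_)
    exact_mod_cast hK s hs

variable [IsProbabilityMeasure μ]

lemma measure_increment_ne_zero_le (hX : IsMarkovCountingSystem μ X N)
    (hhom : IsTimeHomogeneous μ X N) (hlam : HasRateFunction μ X N lam) {t : ℝ≥0} (h : ℝ≥0)
    {x : ζ → ℤ} (hx : μ (X t ⁻¹' {x}) ≠ 0) :
    (μ[|X t ⁻¹' {x}]) {ω | increment N t h ω ≠ 0} ≤ (lam x * h : ℝ≥0) := by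
  have hP : IsProbabilityMeasure (μ[|X t ⁻¹' {x}]) := cond_isProbabilityMeasure hx
  have h1 := one_sub_rate_mul_le hX hhom hlam h hx
  rw [condLaw_real_zero hX] at h1
  have e : {ω | increment N t h ω ≠ 0} = {ω | ∀ p, increment N t h ω p = 0}ᶜ := by
    ext ω; simp [funext_iff]
  rw [← ENNReal.ofReal_coe_nnreal, ENNReal.le_ofReal_iff_toReal_le (measure_ne_top _ _)
    (NNReal.coe_nonneg _), ← measureReal_def, e, probReal_compl_eq_one_sub]
  · push_cast; linarith
  · exact hX.measurable_increment t h
      (Set.to_countable {ν : Transition ζ → ℕ | ∀ p, ν p = 0}).measurableSet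

lemma tendsto_setLIntegral_increment_ne_zero (hX : IsMarkovCountingSystem μ X N)
    (hhom : IsTimeHomogeneous μ X N) (hlam : HasRateFunction μ X N lam) {t : ℝ≥0}
    {x : ζ → ℤ} (hx : μ (X t ⁻¹' {x}) ≠ 0) {f : Ω → ℝ≥0∞}
    (hf : ∫⁻ ω, f ω ∂(μ[|X t ⁻¹' {x}]) ≠ ∞) :
    Tendsto (fun h : ℝ≥0 => ∫⁻ ω in {ω | increment N t h ω ≠ 0}, f ω ∂(μ[|X t ⁻¹' {x}]))
      (𝓝[>] 0) (𝓝 0) := by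
  refine tendsto_setLIntegral_zero hf ?_
  have hlim : Tendsto (fun h : ℝ≥0 => ((lam x * h : ℝ≥0) : ℝ≥0∞)) (𝓝[>] 0) (𝓝 0) := by
    rw [← ENNReal.coe_zero, ENNReal.tendsto_coe]
    have : Tendsto (fun h : ℝ≥0 => lam x * h) (𝓝 0) (𝓝 (lam x * 0)) := tendsto_id.const_mul _
    rw [mul_zero] at this
    exact this.mono_left nhdsWithin_le_nhds
  exact tendsto_of_tendsto_of_tendsto_of_le_of_le tendsto_const_nhds hlim (fun _ => zero_le)
    fun h => measure_increment_ne_zero_le hX hhom hlam h hx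

lemma eventually_four_mul_le {hbar : ℝ≥0} (hbar0 : 0 < hbar) :
    ∀ᶠ h : ℝ≥0 in 𝓝[>] 0, 4 * h ≤ hbar := by
  have : Tendsto (fun h : ℝ≥0 => 4 * h) (𝓝 0) (𝓝 (4 * 0)) := tendsto_id.const_mul _
  rw [mul_zero] at this
  exact ((this.mono_left nhdsWithin_le_nhds).eventually (gt_mem_nhds hbar0)).mono fun _ h => h.le

lemma eventually_lintegral_increment_le (hX : IsMarkovCountingSystem μ X N)
    (hhom : IsTimeHomogeneous μ X N) (hq : HasInfinitesimalProbabilities μ X N q)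
    (hlam : HasRateFunction μ X N lam) (hsc : IsStableConservative μ X q lam) {t hbar : ℝ≥0}
    (hbar0 : 0 < hbar) {x : ζ → ℤ} (hx : μ (X t ⁻¹' {x}) ≠ 0) (ha : 0 < lam x)
    (hsum : Summable fun i : ℕ+ => (i : ℝ) * (q p x i : ℝ))
    (hY : ∫⁻ ω, jumpBound (N p) t hbar ω * rateBound X lam t hbar ω ∂(μ[|X t ⁻¹' {x}]) ≠ ∞)
    {ε : ℝ} (hε : 0 < ε) :
    ∀ᶠ h : ℝ≥0 in 𝓝[>] 0, ∫⁻ ω, (increment N t h ω p : ℝ≥0∞) ∂(μ[|X t ⁻¹' {x}])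
      ≤ ENNReal.ofReal (h * (∑' i : ℕ+, (i : ℝ) * (q p x i : ℝ) + ε)) := by
  obtain ⟨c, hc0, hgrid⟩ := exists_grid ha hbar0
  have hc : (0 : ℝ) < c := hc0
  set m := ∑' i : ℕ+, (i : ℝ) * (q p x i : ℝ) with hm
  have hm0 : 0 ≤ m := tsum_nonneg fun i => by positivity
  have hI := (tendsto_setLIntegral_increment_ne_zero hX hhom hlam hx hY).eventually
    (gt_mem_nhds (show (0 : ℝ≥0∞) < ENNReal.ofReal (c * (ε / 2)) from
      ENNReal.ofReal_pos.2 (by positivity)))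
  filter_upwards [hI, eventually_four_mul_le hbar0, self_mem_nhdsWithin] with h hI h4 hh
  obtain ⟨R, hR, hev⟩ := hgrid h hh h4
  have h1 := lintegral_increment_le hX hhom hq hlam hsc hx ha hh hR hev hsum (half_pos hε) hY
  refine (ENNReal.mul_le_mul_iff_right (ENNReal.coe_ne_zero.2 hc0.ne') ENNReal.coe_ne_top).1
    (h1.trans ((add_le_add le_rfl (mul_le_mul' le_rfl hI.le)).trans (le_of_eq ?_)))
  rw [← ENNReal.ofReal_coe_nnreal (p := c), ← ENNReal.ofReal_coe_nnreal (p := h),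
    ← ENNReal.ofReal_mul (by positivity), ← ENNReal.ofReal_mul (by positivity),
    ← ENNReal.ofReal_mul (by positivity), ← ENNReal.ofReal_add (by positivity) (by positivity)]
  congr 1
  ring

lemma eventually_lintegral_increment_sq_le (hX : IsMarkovCountingSystem μ X N)
    (hhom : IsTimeHomogeneous μ X N) (hq : HasInfinitesimalProbabilities μ X N q)
    (hlam : HasRateFunction μ X N lam) (hsc : IsStableConservative μ X q lam) {t hbar : ℝ≥0}
    (hbar0 : 0 < hbar) {x : ζ → ℤ} (hx : μ (X t ⁻¹' {x}) ≠ 0) (ha : 0 < lam x)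
    (hsum : Summable fun i : ℕ+ => (i : ℝ) ^ 2 * (q p x i : ℝ))
    (hY : ∫⁻ ω, (jumpBound (N p) t hbar ω * rateBound X lam t hbar ω) ^ 2
      ∂(μ[|X t ⁻¹' {x}]) ≠ ∞) {ε : ℝ} (hε : 0 < ε) :
    ∀ᶠ h : ℝ≥0 in 𝓝[>] 0, ∫⁻ ω, (increment N t h ω p : ℝ≥0∞) ^ 2 ∂(μ[|X t ⁻¹' {x}])
      ≤ ENNReal.ofReal (h * (∑' i : ℕ+, (i : ℝ) ^ 2 * (q p x i : ℝ) + ε)) := by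
  obtain ⟨c, hc0, hgrid⟩ := exists_grid ha hbar0
  have hc : (0 : ℝ) < c := hc0
  set m := ∑' i : ℕ+, (i : ℝ) ^ 2 * (q p x i : ℝ) with hm
  have hm0 : 0 ≤ m := tsum_nonneg fun i => by positivity
  have ha' : (lam x : ℝ≥0∞)⁻¹ ≠ ∞ := ENNReal.inv_ne_top.2 (ENNReal.coe_ne_zero.2 ha.ne')
  have hsqrt : Tendsto (fun h : ℝ≥0 => NNReal.sqrt h) (𝓝[>] 0) (𝓝 0) := by
    have : Tendsto (fun h : ℝ≥0 => NNReal.sqrt h) (𝓝 0) (𝓝 (NNReal.sqrt 0)) :=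
      NNReal.continuous_sqrt.tendsto 0
    rw [NNReal.sqrt_zero] at this
    exact this.mono_left nhdsWithin_le_nhds
  have hI : ∀ᶠ h : ℝ≥0 in 𝓝[>] 0,
      (lam x : ℝ≥0∞)⁻¹ * ∫⁻ ω in {ω | increment N t h ω ≠ 0},
          (jumpBound (N p) t hbar ω * rateBound X lam t hbar ω) ^ 2 ∂(μ[|X t ⁻¹' {x}])
        + NNReal.sqrt h * ∫⁻ ω, (jumpBound (N p) t hbar ω * rateBound X lam t hbar ω) ^ 2
          ∂(μ[|X t ⁻¹' {x}]) < ENNReal.ofReal (c * (ε / 4)) := by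
    have h1 := ENNReal.Tendsto.const_mul (a := (lam x : ℝ≥0∞)⁻¹)
      (tendsto_setLIntegral_increment_ne_zero hX hhom hlam hx hY) (Or.inr ha')
    have h2 := ENNReal.Tendsto.mul_const (b := ∫⁻ ω, (jumpBound (N p) t hbar ω
      * rateBound X lam t hbar ω) ^ 2 ∂(μ[|X t ⁻¹' {x}])) (ENNReal.tendsto_coe.2 hsqrt) (Or.inr hY)
    have h3 := h1.add h2
    rw [ENNReal.coe_zero, mul_zero, zero_mul, add_zero] at h3
    exact h3.eventually (gt_mem_nhds (ENNReal.ofReal_pos.2 (by positivity)))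
  have hcs : ∀ᶠ h : ℝ≥0 in 𝓝[>] 0,
      (c : ℝ) * (m + ε / 2) < (c - (NNReal.sqrt h : ℝ)) * (m + ε) := by
    have h1 : Tendsto (fun h : ℝ≥0 => (c - (NNReal.sqrt h : ℝ)) * (m + ε)) (𝓝[>] 0)
        (𝓝 ((c - ((0 : ℝ≥0) : ℝ)) * (m + ε))) :=
      ((NNReal.tendsto_coe.2 hsqrt).const_sub _).mul_const _
    refine h1.eventually (lt_mem_nhds ?_)
    rw [NNReal.coe_zero, sub_zero]
    gcongr
    linarith
  filter_upwards [hI, hcs, eventually_four_mul_le hbar0, self_mem_nhdsWithin] with h hI hcs h4 hh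
  obtain ⟨R, hR, hev⟩ := hgrid h hh h4
  have hs0 : 0 < NNReal.sqrt h := NNReal.sqrt_pos.2 hh
  have hss : NNReal.sqrt h * NNReal.sqrt h = h := NNReal.mul_self_sqrt h
  have hb1 : h * (NNReal.sqrt h)⁻¹ = NNReal.sqrt h := by
    rw [← div_eq_mul_inv, div_eq_iff hs0.ne', hss]
  have h1 := lintegral_increment_sq_le hX hhom hq hlam hsc hx ha hh hR hev hsum
    (show 0 < ε / 4 by linarith) hY (b := (NNReal.sqrt h)⁻¹) (inv_pos.2 hs0)
  rw [hb1, ENNReal.coe_inv hs0.ne', inv_inv, mul_assoc, mul_assoc, add_assoc, ← mul_add] at h1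
  have hcs' : (NNReal.sqrt h : ℝ) < c := by
    by_contra hcon
    push Not at hcon
    have h2 : (c - (NNReal.sqrt h : ℝ)) * (m + ε) ≤ 0 :=
      mul_nonpos_of_nonpos_of_nonneg (by linarith) (by linarith)
    have h3 : 0 ≤ (c : ℝ) * (m + ε / 2) := by positivity
    linarith
  have hcs0 : 0 < c - NNReal.sqrt h := tsub_pos_of_lt (by exact_mod_cast hcs')
  refine (ENNReal.mul_le_mul_iff_right (ENNReal.coe_ne_zero.2 hcs0.ne') ENNReal.coe_ne_top).1
    (h1.trans ((add_le_add le_rfl (mul_le_mul' le_rfl hI.le)).trans ?_))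
  rw [← ENNReal.ofReal_coe_nnreal (p := c), ← ENNReal.ofReal_coe_nnreal (p := h),
    ← ENNReal.ofReal_coe_nnreal (p := c - NNReal.sqrt h),
    ← ENNReal.ofReal_mul (by positivity), ← ENNReal.ofReal_mul (by positivity),
    ← ENNReal.ofReal_mul (by positivity), ← ENNReal.ofReal_add (by positivity) (by positivity),
    NNReal.coe_sub (by exact_mod_cast hcs'.le)]
  refine ENNReal.ofReal_le_ofReal ?_
  have := mul_le_mul_of_nonneg_left hcs.le h.coe_nonneg
  linarith

/-- A sharp upper bound for the moments of small increments determines their limit. -/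
lemma tendsto_moment_div_of_le (hX : IsMarkovCountingSystem μ X N)
    (hq : HasInfinitesimalProbabilities μ X N q) {t : ℝ≥0} {x : ζ → ℤ}
    (hx : μ (X t ⁻¹' {x}) ≠ 0) {k : ℕ} (hsum : Summable fun i : ℕ+ => (i : ℝ) ^ k * (q p x i : ℝ))
    (hle : ∀ ε : ℝ, 0 < ε → ∀ᶠ h : ℝ≥0 in 𝓝[>] 0,
      ∫⁻ ω, (increment N t h ω p : ℝ≥0∞) ^ k ∂(μ[|X t ⁻¹' {x}])
        ≤ ENNReal.ofReal (h * (∑' i : ℕ+, (i : ℝ) ^ k * (q p x i : ℝ) + ε))) :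
    Tendsto (fun h : ℝ≥0 =>
      (∫⁻ ω, (increment N t h ω p : ℝ≥0∞) ^ k ∂(μ[|X t ⁻¹' {x}])).toReal / (h : ℝ)) (𝓝[>] 0)
      (𝓝 (∑' i : ℕ+, (i : ℝ) ^ k * (q p x i : ℝ))) := by
  have hP : IsProbabilityMeasure (μ[|X t ⁻¹' {x}]) := cond_isProbabilityMeasure hx
  set P := μ[|X t ⁻¹' {x}]
  set m := ∑' i : ℕ+, (i : ℝ) ^ k * (q p x i : ℝ) with hm
  have hm0 : 0 ≤ m := tsum_nonneg fun i => by positivity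
  refine tendsto_order.2 ⟨fun B hB => ?_, fun B hB => ?_⟩
  · obtain ⟨T, hT⟩ := ((tendsto_order.1 hsum.hasSum).1 B hB).exists
    have hlim : Tendsto (fun h : ℝ≥0 => ∑ i ∈ T, (i : ℝ) ^ k
        * (P.real (onlyEvent N t h (p, i)) / (h : ℝ))) (𝓝[>] 0)
        (𝓝 (∑ i ∈ T, (i : ℝ) ^ k * (q p x i : ℝ))) :=
      tendsto_finsetSum _ fun i _ => (hq t x hx p i).const_mul _
    filter_upwards [hlim.eventually (lt_mem_nhds hT), hle 1 one_pos, self_mem_nhdsWithin]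
      with h hh hfin hpos
    have hpos' : (0 : ℝ) < h := hpos
    refine hh.trans_le ?_
    have h1 := sum_pow_mul_measure_le (p := p) hX P t h k T
      (fun i hi => Finset.le_sup (f := fun i : ℕ+ => (i : ℕ)) hi)
    have h2 : ∑ i ∈ T, ((i : ℕ) : ℝ≥0∞) ^ k * P (onlyEvent N t h (p, i))
        ≤ ∫⁻ ω, (increment N t h ω p : ℝ≥0∞) ^ k ∂P := h1.trans <| lintegral_mono fun ω => by
      gcongr; exact min_le_left _ _
    have h3 := ENNReal.toReal_mono (ne_top_of_le_ne_top ENNReal.ofReal_ne_top hfin) h2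
    rw [ENNReal.toReal_sum (fun i _ => by finiteness)] at h3
    simp only [ENNReal.toReal_mul, ENNReal.toReal_pow, ENNReal.toReal_natCast,
      ← measureReal_def] at h3
    simp only [← mul_div_assoc, ← Finset.sum_div]
    gcongr
  · filter_upwards [hle ((B - m) / 2) (by linarith), self_mem_nhdsWithin] with h hh hpos
    have hpos' : (0 : ℝ) < h := hpos
    have h1 := ENNReal.toReal_mono ENNReal.ofReal_ne_top hh
    rw [ENNReal.toReal_ofReal (by positivity [show 0 < B - m by linarith])] at h1
    rw [div_lt_iff₀ hpos']
    refine h1.trans_lt ?_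
    rw [mul_comm B]
    gcongr
    linarith

lemma lintegral_increment_pow_eq_zero (hX : IsMarkovCountingSystem μ X N)
    (hhom : IsTimeHomogeneous μ X N) (hlam : HasRateFunction μ X N lam) {t : ℝ≥0} (h : ℝ≥0)
    {x : ζ → ℤ} (hx : μ (X t ⁻¹' {x}) ≠ 0) (h0 : lam x = 0) {k : ℕ} (hk : k ≠ 0) :
    ∫⁻ ω, (increment N t h ω p : ℝ≥0∞) ^ k ∂(μ[|X t ⁻¹' {x}]) = 0 := by
  have h1 := measure_increment_ne_zero_le hX hhom hlam h hx
  rw [h0, zero_mul, ENNReal.coe_zero, nonpos_iff_eq_zero] at h1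
  have h2 : ∀ᵐ ω ∂(μ[|X t ⁻¹' {x}]), increment N t h ω = 0 := by
    rw [ae_iff]; exact h1
  rw [lintegral_congr_ae (g := fun _ => 0) (h2.mono fun ω hω => by simp [hω, hk]),
    lintegral_zero]

/-- The first-moment condition bounds the means of small increments. -/
lemma summable_and_eventually_lintegral_le (hX : IsMarkovCountingSystem μ X N)
    (hhom : IsTimeHomogeneous μ X N) (hq : HasInfinitesimalProbabilities μ X N q)
    (hlam : HasRateFunction μ X N lam) (hsc : IsStableConservative μ X q lam) {t hbar : ℝ≥0}
    (hbar0 : 0 < hbar) {x : ζ → ℤ} (hx : μ (X t ⁻¹' {x}) ≠ 0)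
    (hY : ∫⁻ ω, jumpBound (N p) t hbar ω * rateBound X lam t hbar ω ∂(μ[|X t ⁻¹' {x}]) ≠ ∞) :
    Summable (fun i : ℕ+ => (i : ℝ) * (q p x i : ℝ)) ∧
      ∀ ε : ℝ, 0 < ε → ∀ᶠ h : ℝ≥0 in 𝓝[>] 0,
        ∫⁻ ω, (increment N t h ω p : ℝ≥0∞) ∂(μ[|X t ⁻¹' {x}])
          ≤ ENNReal.ofReal (h * (∑' i : ℕ+, (i : ℝ) * (q p x i : ℝ) + ε)) := by
  rcases eq_or_ne (lam x) 0 with h0 | h0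
  · refine ⟨by simp [q_eq_zero_of_rate_eq_zero hsc hx h0, summable_zero], fun ε _ =>
      Eventually.of_forall fun h => ?_⟩
    have := lintegral_increment_pow_eq_zero (p := p) hX hhom hlam h hx h0 one_ne_zero
    simp only [pow_one] at this
    rw [this]; exact zero_le
  · have ha := pos_iff_ne_zero.2 h0
    have hsum : Summable fun i : ℕ+ => (i : ℝ) * (q p x i : ℝ) := by
      have := summable_pow_mul hX hhom hq hlam hbar0 hx ha 0 (p := p) (by simpa using hY)
      simpa using this
    exact ⟨hsum, fun ε hε =>
      eventually_lintegral_increment_le hX hhom hq hlam hsc hbar0 hx ha hsum hY hε⟩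

/-- The second-moment condition bounds the second moments of small increments. -/
lemma summable_and_eventually_lintegral_sq_le (hX : IsMarkovCountingSystem μ X N)
    (hhom : IsTimeHomogeneous μ X N) (hq : HasInfinitesimalProbabilities μ X N q)
    (hlam : HasRateFunction μ X N lam) (hsc : IsStableConservative μ X q lam) {t hbar : ℝ≥0}
    (hbar0 : 0 < hbar) {x : ζ → ℤ} (hx : μ (X t ⁻¹' {x}) ≠ 0)
    (hY : ∫⁻ ω, (jumpBound (N p) t hbar ω * rateBound X lam t hbar ω) ^ 2
      ∂(μ[|X t ⁻¹' {x}]) ≠ ∞) :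
    Summable (fun i : ℕ+ => (i : ℝ) ^ 2 * (q p x i : ℝ)) ∧
      ∀ ε : ℝ, 0 < ε → ∀ᶠ h : ℝ≥0 in 𝓝[>] 0,
        ∫⁻ ω, (increment N t h ω p : ℝ≥0∞) ^ 2 ∂(μ[|X t ⁻¹' {x}])
          ≤ ENNReal.ofReal (h * (∑' i : ℕ+, (i : ℝ) ^ 2 * (q p x i : ℝ) + ε)) := by
  rcases eq_or_ne (lam x) 0 with h0 | h0
  · refine ⟨by simp [q_eq_zero_of_rate_eq_zero hsc hx h0, summable_zero], fun ε _ =>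
      Eventually.of_forall fun h => ?_⟩
    rw [lintegral_increment_pow_eq_zero (p := p) hX hhom hlam h hx h0 two_ne_zero]
    exact zero_le
  · have ha := pos_iff_ne_zero.2 h0
    have hsum := summable_pow_mul hX hhom hq hlam hbar0 hx ha 1 (p := p) hY
    exact ⟨hsum, fun ε hε =>
      eventually_lintegral_increment_sq_le hX hhom hq hlam hsc hbar0 hx ha hsum hY hε⟩

/-- Infinitesimal mean under a finite first moment of `jumpBound * rateBound`. -/
lemma summable_and_hasInfinitesimalMean (hX : IsMarkovCountingSystem μ X N)
    (hhom : IsTimeHomogeneous μ X N) (hq : HasInfinitesimalProbabilities μ X N q)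
    (hlam : HasRateFunction μ X N lam) (hsc : IsStableConservative μ X q lam) {t hbar : ℝ≥0}
    (hbar0 : 0 < hbar) {x : ζ → ℤ} (hx : μ (X t ⁻¹' {x}) ≠ 0)
    (hY : ∫⁻ ω, jumpBound (N p) t hbar ω * rateBound X lam t hbar ω ∂(μ[|X t ⁻¹' {x}]) ≠ ∞) :
    Summable (fun k : ℕ+ => (k : ℝ) * (q p x k : ℝ)) ∧
      HasInfinitesimalMean μ X N p t x (∑' k : ℕ+, (k : ℝ) * (q p x k : ℝ)) := by
  obtain ⟨hsum, hle⟩ := summable_and_eventually_lintegral_le hX hhom hq hlam hsc hbar0 hx hY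
  have hlim := tendsto_moment_div_of_le (k := 1) hX hq hx (by simpa using hsum)
    (by simpa using hle)
  refine ⟨hsum, (hle 1 one_pos).mono fun h hh => ?_, ?_⟩
  · have := integrable_increment_pow (p := p) hX (P := μ[|X t ⁻¹' {x}]) (t := t) (h := h) (k := 1)
      (by simpa using ne_top_of_le_ne_top ENNReal.ofReal_ne_top hh)
    simpa using this
  · have e := fun h => integral_increment_pow (p := p) hX (μ[|X t ⁻¹' {x}]) t h 1
    simp only [pow_one] at e hlim
    simpa only [e] using hlim

/-- Infinitesimal variance under a finite second moment of `jumpBound * rateBound`. -/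
lemma summable_and_hasInfinitesimalVariance (hX : IsMarkovCountingSystem μ X N)
    (hhom : IsTimeHomogeneous μ X N) (hq : HasInfinitesimalProbabilities μ X N q)
    (hlam : HasRateFunction μ X N lam) (hsc : IsStableConservative μ X q lam) {t hbar : ℝ≥0}
    (hbar0 : 0 < hbar) {x : ζ → ℤ} (hx : μ (X t ⁻¹' {x}) ≠ 0)
    (hY : ∫⁻ ω, (jumpBound (N p) t hbar ω * rateBound X lam t hbar ω) ^ 2
      ∂(μ[|X t ⁻¹' {x}]) ≠ ∞) :
    Summable (fun k : ℕ+ => (k : ℝ) ^ 2 * (q p x k : ℝ)) ∧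
      HasInfinitesimalVariance μ X N p t x (∑' k : ℕ+, (k : ℝ) ^ 2 * (q p x k : ℝ)) := by
  have hP : IsProbabilityMeasure (μ[|X t ⁻¹' {x}]) := cond_isProbabilityMeasure hx
  have hY1 : ∫⁻ ω, jumpBound (N p) t hbar ω * rateBound X lam t hbar ω ∂(μ[|X t ⁻¹' {x}]) ≠ ∞ := by
    refine ne_top_of_le_ne_top (b := ∫⁻ ω, ((jumpBound (N p) t hbar ω
      * rateBound X lam t hbar ω) ^ 2 + 1) ∂(μ[|X t ⁻¹' {x}])) ?_ (lintegral_mono fun ω => ?_)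
    · rw [lintegral_add_right _ measurable_const]
      simpa using hY
    · set y := jumpBound (N p) t hbar ω * rateBound X lam t hbar ω
      rcases le_total y 1 with h | h
      · exact h.trans le_add_self
      · exact (le_self_pow₀ h two_ne_zero).trans le_self_add
  obtain ⟨-, -, hmean⟩ := summable_and_hasInfinitesimalMean hX hhom hq hlam hsc hbar0 hx hY1
  obtain ⟨hsum, hle⟩ := summable_and_eventually_lintegral_sq_le hX hhom hq hlam hsc hbar0 hx hY
  have hlim := tendsto_moment_div_of_le hX hq hx hsum hle
  have hmem : ∀ᶠ h : ℝ≥0 in 𝓝[>] 0,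
      MemLp (fun ω => (increment N t h ω p : ℝ)) 2 (μ[|X t ⁻¹' {x}]) :=
    (hle 1 one_pos).mono fun h hh =>
      (memLp_two_iff_integrable_sq (measurable_increment_real hX t h).aestronglyMeasurable).2
        (integrable_increment_pow hX (ne_top_of_le_ne_top ENNReal.ofReal_ne_top hh))
  refine ⟨hsum, hmem, ?_⟩
  have hh0 : Tendsto (fun h : ℝ≥0 => (h : ℝ)) (𝓝[>] 0) (𝓝 0) := by
    have : Tendsto (fun h : ℝ≥0 => (h : ℝ)) (𝓝 0) (𝓝 ((0 : ℝ≥0) : ℝ)) :=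
      NNReal.continuous_coe.tendsto 0
    rw [NNReal.coe_zero] at this
    exact this.mono_left nhdsWithin_le_nhds
  have hcomb := hlim.sub ((hmean.mul hmean).mul hh0)
  rw [mul_zero, sub_zero] at hcomb
  refine hcomb.congr' ?_
  filter_upwards [hmem, self_mem_nhdsWithin] with h hm hpos
  have hpos' : (h : ℝ) ≠ 0 := (show (0 : ℝ) < h from hpos).ne'
  rw [variance_eq_sub hm, ← integral_increment_pow hX]
  simp only [Pi.pow_apply]
  field_simp

end Limits

end MCS

theorem mainTheorem1 {ζ : Type*} [Fintype ζ] [DecidableEq ζ]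
    {Ω : Type*} [MeasurableSpace Ω] (μ : Measure Ω) [IsProbabilityMeasure μ]
    (X : ℝ≥0 → Ω → ζ → ℤ) (N : MCS.Transition ζ → ℝ≥0 → Ω → ℕ)
    (q : MCS.Transition ζ → (ζ → ℤ) → ℕ+ → ℝ≥0) (lam : (ζ → ℤ) → ℝ≥0)
    (hX : MCS.IsMarkovCountingSystem μ X N)
    (hhom : MCS.IsTimeHomogeneous μ X N)
    (hq : MCS.HasInfinitesimalProbabilities μ X N q)
    (hlam : MCS.HasRateFunction μ X N lam)
    (hsc : MCS.IsStableConservative μ X q lam) :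
    (MCS.P3 μ X N lam →
      ∀ (t : ℝ≥0) (x : ζ → ℤ), μ (X t ⁻¹' {x}) ≠ 0 → ∀ p : MCS.Transition ζ,
        Summable (fun k : ℕ+ => (k : ℝ) * (q p x k : ℝ)) ∧
        MCS.HasInfinitesimalMean μ X N p t x (∑' k : ℕ+, (k : ℝ) * (q p x k : ℝ))) ∧
    (MCS.P4 μ X N lam →
      ∀ (t : ℝ≥0) (x : ζ → ℤ), μ (X t ⁻¹' {x}) ≠ 0 → ∀ p : MCS.Transition ζ,
        Summable (fun k : ℕ+ => (k : ℝ) ^ 2 * (q p x k : ℝ)) ∧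
        MCS.HasInfinitesimalVariance μ X N p t x (∑' k : ℕ+, (k : ℝ) ^ 2 * (q p x k : ℝ))) := by
  refine ⟨fun h3 t x hx p => ?_, fun h4 t x hx p => ?_⟩
  · obtain ⟨hbar, hbar0, hY⟩ := h3 t x hx p
    exact MCS.summable_and_hasInfinitesimalMean hX hhom hq hlam hsc hbar0 hx hY.ne
  · obtain ⟨hbar, hbar0, hY⟩ := h4 t x hx p
    have := cond_isProbabilityMeasure hx
    refine MCS.summable_and_hasInfinitesimalVariance hX hhom hq hlam hsc hbar0 hx ?_
    have h1 := MCS.lintegral_enorm_sq_ne_top_of_evariance hY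
    refine ne_of_eq_of_ne (lintegral_congr fun ω => ?_) h1
    rw [Real.enorm_eq_ofReal ENNReal.toReal_nonneg,
      ENNReal.ofReal_toReal (MCS.jumpBound_mul_rateBound_ne_top hX t hbar ω)]
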